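/- Let $m_1,m_2,k$ be positive integers with $m_1,m_2$ odd and $k$ even. The cubic lattice $Q=Q(m_1m_2k)$ is the graph with vertices $V_{xyz}$, $1\le x\le m_1$, $1\le y\le m_2$, $1\le z\le k$, and with the vertical edges $\{V_{xyz},V_{xy(z+1)}\}$, the width edges $\{V_{xyz},V_{x(y+1)z}\}$ and the horizontal edges $\{V_{xyz},V_{(x+1)yz}\}$. Order its vertices linearly by $$V(11),\ \bar V(12),\ V(13),\dots,V(1m_2),\ \bar V(2m_2),\ V(2(m_2-1)),\dots,V(m_1m_2),$$ where $V(xy)=V_{xy1},\dots,V_{xyk}$ and $\bar V(xy)$ is its reversal; the coordinate $y$ is traversed alternately upwards and downwards, and every second column is reversed. Each edge $e$ of $Q$ has a real weight $w(e)$; put $w(A)=\sum_{e\in A}w(e)$ for a set $A$ of edges, and for $\alpha>0$ let $\mathcal P(Q,\alpha)=\sum_P\alpha^{w(P)}$ be the dimer partition function, the sum being over all perfect matchings $P$ of $Q$. *Orientations and determinants.* For an orientation $D$ of $Q$ and an edge $e$, let $\mathrm{sign}(D,e)=1$ if $D$ directs $e$ from its smaller to its larger vertex, and $\mathrm{sign}(D,e)=-1$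 otherwise; $e$ is called positive in $D$ in the first case. Let $V_1\ni V_{111}$ and $V_2$ be the two colour classes of the bipartite graph $Q$. Let $Z(D)$ be the $V_1\times V_2$ matrix, with rows and columns in the fixed order, whose $(i,j)$ entry is $0$ if $\{i,j\}$ is not an edge, and for an edge $e=\{i,j\}$ is $\mathrm{sign}(D,e)\,\alpha^{w(e)}$ if $i<j$ and $-\mathrm{sign}(D,e)\,\alpha^{w(e)}$ if $i>j$. *The set $R(Q)$.* The layers of $Q$ are the set $H$ of all horizontal edges and, for each $x\le m_1$, the set $W_x$ of all width edges with first coordinate $x$. Draw each layer as the set of horizontal edges of a square grid whose lower left corner is the smallest vertex of the layer: for $H$ the grid has $m_1$ columns, one for each $x$, and $km_2$ rows, the row number of $V_{xyz}$ being the place of $V_{1yz}$ in the fixed order; for $W_x$ it has $m_2$ columns and $k$ rows, $V_{xyz}$ being in column $y$ and row $z$ if $x$ is odd, and in column $m_2+1-y$ and row $k+1-z$ if $x$ is even. For an edge $e$ of a layer $L$ let $h(L,e)$ and $v(L,e)$ be the column and the row number of its first (left) vertex. Let $R(L)$ be the set of all pairs $(e,e')$ of edges of $L$ with $h(L,e')<h(L,e)$,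 $v(L,e)\le v(L,e')\le v(L,e)+1$, $h(L,e)$ even and $h(L,e')$ odd. Let $R(Q)$ be the union of $R(L)$ over all layers $L$. **Theorem.** Let $C=km_1(m_2-1)/2+km_2(m_1-1)/2$. Then $Q$ has exactly one perfect matching $M$ that consists of vertical edges only, and $$\mathcal P(Q,\alpha)=(2^C+1)\,\mathcal E-2^C\alpha^{w(M)},$$ where $\mathcal E$ is the average of $\det Z(D)$ over all orientations $D$ of $Q$ in which all vertical edges are positive and for which the number of pairs $(e,e')\in R(Q)$ with $\mathrm{sign}(D,e)=\mathrm{sign}(D,e')=-1$ is even. The same identity holds with arbitrary edge variables: if each edge $e$ is assigned an element $c_e$ of a field of characteristic $0$, and $\alpha^{w(e)}$ and $\alpha^{w(A)}$ are replaced by $c_e$ and $\prod_{e\in A}c_e$ throughout. -/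

import Mathlib

/-- `P` is a perfect matching (dimer arrangement) of `G`: a set of edges of `G` such that every
vertex belongs to exactly one element of `P`. -/
def IsDimer {V : Type*} (G : SimpleGraph V) (P : Finset (Sym2 V)) : Prop :=
  (∀ e ∈ P, e ∈ G.edgeSet) ∧ ∀ v : V, ∃! e : Sym2 V, e ∈ P ∧ v ∈ e

open scoped Classical in
/-- The generating function of perfect matchings with one variable `x e` per edge:
`∑_P ∏_{e ∈ P} x e` over all perfect matchings `P` of `G`. -/
noncomputable def dimerGenFun {V : Type*} [Fintype V] {K : Type*} [CommSemiring K]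
    (G : SimpleGraph V) (x : Sym2 V → K) : K :=
  ∑ P : Finset (Sym2 V) with IsDimer G P, ∏ e ∈ P, x e

/-- The weight `w(A)` of a set of edges. -/
noncomputable def setWeight {V : Type*} (w : Sym2 V → ℝ) (A : Finset (Sym2 V)) : ℝ :=
  ∑ e ∈ A, w e

open scoped Classical in
/-- The dimer partition function `𝒫(G, α) = ∑_P α ^ w(P)` over all perfect matchings `P`. -/
noncomputable def dimerPartition {V : Type*} [Fintype V]
    (G : SimpleGraph V) (w : Sym2 V → ℝ) (α : ℝ) : ℝ :=
  ∑ P : Finset (Sym2 V) with IsDimer G P, α ^ setWeight w P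

/-- `D` is an orientation of `G`: its arcs are obtained by ordering the two elements of each
edge of `G`. -/
def IsOrientation {V : Type*} (G : SimpleGraph V) (D : Digraph V) : Prop :=
  (∀ u v, D.Adj u v → G.Adj u v) ∧ ∀ u v, G.Adj u v → (D.Adj u v ↔ ¬ D.Adj v u)

/-- The vertices of the `m₁ × m₂ × k` lattice. Coordinates start at `0`, so the vertex
`V_{xyz}` with `1 ≤ x ≤ m₁`, `1 ≤ y ≤ m₂`, `1 ≤ z ≤ k` is `⟨x - 1, y - 1, z - 1⟩`. -/
@[ext]
structure Site (m₁ m₂ k : ℕ) where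
  x : Fin m₁
  y : Fin m₂
  z : Fin k

namespace Site

variable {m₁ m₂ k : ℕ}

/-- Sites are triples of coordinates. -/
def equivProd (m₁ m₂ k : ℕ) : Fin m₁ × Fin m₂ × Fin k ≃ Site m₁ m₂ k where
  toFun t := ⟨t.1, t.2.1, t.2.2⟩
  invFun u := (u.x, u.y, u.z)
  left_inv _ := rfl
  right_inv _ := rfl

instance : Fintype (Site m₁ m₂ k) := Fintype.ofEquiv _ (equivProd m₁ m₂ k)

/-- Number of the column `V(xy)` of `u` in the list
`V(11), V(12), …, V(1m₂), V(2m₂), V(2(m₂-1)), …` of all columns (counted from `0`): the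
coordinate `y` is traversed upwards and downwards alternately. -/
def column (u : Site m₁ m₂ k) : ℕ :=
  u.x * m₂ + if Even (u.x : ℕ) then (u.y : ℕ) else m₂ - 1 - u.y

/-- Place of `u` within its column: the columns are alternately listed upwards
(`V(xy) = V_{xy1}, …, V_{xyk}`) and reversed. -/
def height (u : Site m₁ m₂ k) : ℕ :=
  if Even u.column then (u.z : ℕ) else k - 1 - u.z

/-- Position (counted from `0`) of a vertex in the fixed linear order
`V(11), V̄(12), …, V(1m₂), V̄(2m₂), V(2(m₂-1)), …, V(m₁m₂)`. -/
def pos (u : Site m₁ m₂ k) : ℕ := u.column * k + u.height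

theorem height_lt (u : Site m₁ m₂ k) : u.height < k := by
  have := u.z.isLt
  unfold height
  split_ifs <;> omega

theorem mixed_radix_inj {b q q' r r' : ℕ} (hr : r < b) (hr' : r' < b)
    (h : q * b + r = q' * b + r') : q = q' ∧ r = r' := by
  have hb : 0 < b := by omega
  have h1 : (q * b + r) / b = q := by
    rw [mul_comm, Nat.mul_add_div hb, Nat.div_eq_of_lt hr, add_zero]
  have h2 : (q' * b + r') / b = q' := by
    rw [mul_comm, Nat.mul_add_div hb, Nat.div_eq_of_lt hr', add_zero]
  have hq : q = q' := by rw [← h1, ← h2, h]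
  subst hq
  exact ⟨rfl, by omega⟩

theorem pos_injective : Function.Injective (pos : Site m₁ m₂ k → ℕ) := by
  intro u v h
  obtain ⟨hc, hh⟩ := mixed_radix_inj u.height_lt v.height_lt h
  have hyu := u.y.isLt
  have hyv := v.y.isLt
  have hzu := u.z.isLt
  have hzv := v.z.isLt
  have hz : (u.z : ℕ) = v.z := by
    unfold height at hh
    rw [hc] at hh
    split_ifs at hh <;> omega
  have hxy : (u.x : ℕ) = v.x ∧
      (if Even (u.x : ℕ) then (u.y : ℕ) else m₂ - 1 - u.y)
        = if Even (v.x : ℕ) then (v.y : ℕ) else m₂ - 1 - v.y := by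
    refine mixed_radix_inj (b := m₂) ?_ ?_ hc
    · split_ifs <;> omega
    · split_ifs <;> omega
  have hy : (u.y : ℕ) = v.y := by
    have h2 := hxy.2
    rw [hxy.1] at h2
    split_ifs at h2 <;> omega
  exact Site.ext (Fin.ext hxy.1) (Fin.ext hy) (Fin.ext hz)

/-- The fixed linear order on the vertices of the lattice. -/
noncomputable instance : LinearOrder (Site m₁ m₂ k) := LinearOrder.lift' pos pos_injective

end Site

namespace CubicLattice

open scoped Classical in
/-- The vertical edges `{V_{xyz}, V_{xy(z+1)}}`. -/
noncomputable def verticalEdges (m₁ m₂ k : ℕ) : Finset (Sym2 (Site m₁ m₂ k)) :=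
  {e | ∃ u v : Site m₁ m₂ k, e = s(u, v) ∧ u.x = v.x ∧ u.y = v.y ∧ (u.z : ℕ) + 1 = v.z}

open scoped Classical in
/-- The layer `W_x`: the width edges `{V_{xyz}, V_{x(y+1)z}}` with the given `x`. -/
noncomputable def widthEdges (m₁ m₂ k : ℕ) (x : Fin m₁) : Finset (Sym2 (Site m₁ m₂ k)) :=
  {e | ∃ u v : Site m₁ m₂ k,
    e = s(u, v) ∧ u.x = x ∧ v.x = x ∧ (u.y : ℕ) + 1 = v.y ∧ u.z = v.z}

open scoped Classical in
/-- The layer `H`: the horizontal edges `{V_{xyz}, V_{(x+1)yz}}`. -/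
noncomputable def horizontalEdges (m₁ m₂ k : ℕ) : Finset (Sym2 (Site m₁ m₂ k)) :=
  {e | ∃ u v : Site m₁ m₂ k, e = s(u, v) ∧ (u.x : ℕ) + 1 = v.x ∧ u.y = v.y ∧ u.z = v.z}

/-- The cubic lattice `Q(m₁ m₂ k)`. -/
noncomputable def graph (m₁ m₂ k : ℕ) : SimpleGraph (Site m₁ m₂ k) :=
  SimpleGraph.fromEdgeSet
    {e | e ∈ verticalEdges m₁ m₂ k ∨ (∃ x, e ∈ widthEdges m₁ m₂ k x) ∨
      e ∈ horizontalEdges m₁ m₂ k}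

variable {m₁ m₂ k : ℕ}

/-! Each layer is drawn as the set of horizontal edges of a square grid. The functions below are
the grid coordinates (counted from `1`) of a vertex in the drawing of a layer. -/

/-- Horizontal coordinate in the drawing of `H`. -/
def hCoordH (u : Site m₁ m₂ k) : ℕ := u.x + 1

/-- Vertical coordinate in the drawing of `H`: the first grid column consists of the vertices with
`x = 1`, listed in the fixed linear order, and `u` is in the row of the vertex of that
column that has the same `y` and `z` as `u`. -/
def vCoordH (u : Site m₁ m₂ k) : ℕ :=
  Site.pos (⟨⟨0, u.x.pos⟩, u.y, u.z⟩ : Site m₁ m₂ k) + 1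

/-- Horizontal coordinate in the drawing of the layer `W_x` containing `u`. The lower left corner
is the smallest vertex of the layer: `V_{x11}` if `x` is odd, and `V_{x m₂ k}` if `x` is even (recall
that `u.x = x - 1`). -/
def hCoordW (u : Site m₁ m₂ k) : ℕ := if Even (u.x : ℕ) then u.y + 1 else m₂ - u.y

/-- Vertical coordinate in the drawing of the layer `W_x` containing `u`. -/
def vCoordW (u : Site m₁ m₂ k) : ℕ := if Even (u.x : ℕ) then u.z + 1 else k - u.z

open scoped Classical in
/-- The set `R(L)` for a layer `L` drawn with grid coordinates `h`, `v`: all pairs `(e, e')` of edges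
of `L` with `h(L,e') < h(L,e)`, `v(L,e) ≤ v(L,e') ≤ v(L,e) + 1`, `h(L,e)` even and `h(L,e')` odd.
The coordinates of an edge are those of its first vertex `e.inf`. -/
noncomputable def layerPairs (L : Finset (Sym2 (Site m₁ m₂ k))) (h v : Site m₁ m₂ k → ℕ) :
    Finset (Sym2 (Site m₁ m₂ k) × Sym2 (Site m₁ m₂ k)) :=
  {p ∈ L ×ˢ L | h p.2.inf < h p.1.inf ∧ v p.1.inf ≤ v p.2.inf ∧ v p.2.inf ≤ v p.1.inf + 1 ∧
    Even (h p.1.inf) ∧ Odd (h p.2.inf)}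

open scoped Classical in
/-- The set of pairs of edges `R(Q)`: the union of `R(L)` over the layers `H` and `W_x`. -/
noncomputable def pairs (m₁ m₂ k : ℕ) :
    Finset (Sym2 (Site m₁ m₂ k) × Sym2 (Site m₁ m₂ k)) :=
  layerPairs (horizontalEdges m₁ m₂ k) hCoordH vCoordH ∪
    Finset.univ.biUnion fun x => layerPairs (widthEdges m₁ m₂ k x) hCoordW vCoordW

open scoped Classical in
/-- `sign(D, e)`: it is `1` if the arc of `D` on the edge `e` goes from the smaller to the larger
vertex of `e`, and `-1` otherwise. -/
noncomputable def edgeSign (D : Digraph (Site m₁ m₂ k)) (e : Sym2 (Site m₁ m₂ k)) : ℤ :=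
  if D.Adj e.inf e.sup then 1 else -1

/-- The colour class `V₁` of the bipartite graph `Q`, the one that contains `V₁₁₁`. -/
noncomputable def classOne (m₁ m₂ k : ℕ) : Finset (Site m₁ m₂ k) :=
  {u | Even ((u.x : ℕ) + u.y + u.z)}

/-- The other colour class `V₂`. -/
noncomputable def classTwo (m₁ m₂ k : ℕ) : Finset (Site m₁ m₂ k) :=
  {u | Odd ((u.x : ℕ) + u.y + u.z)}

theorem card_classTwo (hk : Even k) : (classTwo m₁ m₂ k).card = (classOne m₁ m₂ k).card := by
  refine Finset.card_bij' (fun u _ => (⟨u.x, u.y, u.z.rev⟩ : Site m₁ m₂ k))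
    (fun u _ => ⟨u.x, u.y, u.z.rev⟩) ?_ ?_ ?_ ?_
  · intro u hu
    have := u.z.isLt
    simp only [classOne, classTwo, Finset.mem_filter, Finset.mem_univ, true_and, Fin.val_rev]
      at hu ⊢
    grind
  · intro u hu
    have := u.z.isLt
    simp only [classOne, classTwo, Finset.mem_filter, Finset.mem_univ, true_and, Fin.val_rev]
      at hu ⊢
    grind
  · intro u _
    simp
  · intro u _
    simp

open scoped Classical in
/-- The entries `𝒵_{ij}`: `0` if `{i, j}` is no edge of `Q`, and otherwise the variable of the edge
`{i, j}` with the sign `+` if `i < j` and `-` if `i > j`. -/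
noncomputable def entry {K : Type*} [Ring K] (c : Sym2 (Site m₁ m₂ k) → K)
    (i j : Site m₁ m₂ k) : K :=
  if (graph m₁ m₂ k).Adj i j then (if i < j then c s(i, j) else -c s(i, j)) else 0

/-- The signing `Z(D)` of `𝒵` that corresponds to `D`: the entry of an edge is multiplied by `-1` if
its arc in `D` goes from the larger to the smaller vertex. The rows (columns) are the vertices
of `V₁` (of `V₂`), in the fixed linear order. -/
noncomputable def signedMatrix {K : Type*} [Ring K] (hk : Even k) (c : Sym2 (Site m₁ m₂ k) → K)
    (D : Digraph (Site m₁ m₂ k)) :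
    Matrix (Fin (classOne m₁ m₂ k).card) (Fin (classOne m₁ m₂ k).card) K :=
  Matrix.of fun a b =>
    let i := (classOne m₁ m₂ k).orderEmbOfFin rfl a
    let j := (classTwo m₁ m₂ k).orderEmbOfFin (card_classTwo hk) b
    (edgeSign D s(i, j) : K) * entry c i j

open scoped Classical in
/-- The orientations `D` of `Q` in which all vertical edges are positive and in which the number of
pairs `(e, e') ∈ R(Q)` with `sign(D, e) = sign(D, e') = -1` is even. -/
noncomputable def evenOrientations (m₁ m₂ k : ℕ) : Finset (Digraph (Site m₁ m₂ k)) :=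
  {D | IsOrientation (graph m₁ m₂ k) D ∧ (∀ e ∈ verticalEdges m₁ m₂ k, edgeSign D e = 1) ∧
    Even {p ∈ pairs m₁ m₂ k | edgeSign D p.1 = -1 ∧ edgeSign D p.2 = -1}.card}

/-- The average of `det Z(D)` over the orientations in `evenOrientations`. -/
noncomputable def avgDet {K : Type*} [Field K] (hk : Even k) (c : Sym2 (Site m₁ m₂ k) → K) : K :=
  (∑ D ∈ evenOrientations m₁ m₂ k, (signedMatrix hk c D).det) / (evenOrientations m₁ m₂ k).card

/-- The exponent `C = k m₁ (m₂ - 1) / 2 + k m₂ (m₁ - 1) / 2`; both divisions are exact if `k` is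
even. -/
def halfCount (m₁ m₂ k : ℕ) : ℕ := k * m₁ * (m₂ - 1) / 2 + k * m₂ * (m₁ - 1) / 2

end CubicLattice

/-! ### Signs and parities -/

open scoped Classical in
/-- The indicator of a proposition modulo `2`. -/
noncomputable def parityInd (p : Prop) : ZMod 2 := if p then 1 else 0

theorem parityInd_true {p : Prop} (h : p) : parityInd p = 1 := if_pos h

theorem parityInd_false {p : Prop} (h : ¬ p) : parityInd p = 0 := if_neg h

theorem parityInd_not (p : Prop) : parityInd (¬ p) = 1 + parityInd p := by
  by_cases h : p
  · rw [parityInd_true h, parityInd_false (not_not.2 h)]; rfl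
  · rw [parityInd_false h, parityInd_true h]; rfl

theorem parityInd_and (p q : Prop) : parityInd (p ∧ q) = parityInd p * parityInd q := by
  by_cases hp : p <;> by_cases hq : q <;> simp [parityInd, hp, hq]

/-- The nontrivial character of `ZMod 2`. -/
def parityChar (a : ZMod 2) : ℤ := if a = 0 then 1 else -1

@[simp] theorem parityChar_zero : parityChar 0 = 1 := rfl

theorem parityChar_add (a b : ZMod 2) : parityChar (a + b) = parityChar a * parityChar b := by
  revert a b; decide

theorem parityChar_mul_self (a : ZMod 2) : parityChar a * parityChar a = 1 := by
  revert a; decide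

theorem parityChar_sum {ι : Type*} (s : Finset ι) (f : ι → ZMod 2) :
    parityChar (∑ i ∈ s, f i) = ∏ i ∈ s, parityChar (f i) := by
  classical
  induction s using Finset.induction_on with
  | empty => rfl
  | insert a s ha ih => rw [Finset.sum_insert ha, Finset.prod_insert ha, parityChar_add, ih]

theorem parityChar_parityInd_of_true {p : Prop} (h : p) : parityChar (parityInd p) = -1 := by
  rw [parityInd_true h]; rfl

theorem parityChar_parityInd_of_false {p : Prop} (h : ¬ p) : parityChar (parityInd p) = 1 := by
  rw [parityInd_false h]; rfl

theorem zmod_two_add_self (a : ZMod 2) : a + a = 0 := by revert a; decide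

theorem zmod_two_eq_of_add_eq_zero {a b : ZMod 2} (h : a + b = 0) : a = b := by
  revert a b; decide

theorem sign_eq_parityChar {n : ℕ} (π : Equiv.Perm (Fin n)) :
    ((Equiv.Perm.sign π : ℤˣ) : ℤ) =
      parityChar (∑ a, ∑ b ∈ Finset.Ioi a, parityInd (¬ π a < π b)) := by
  rw [Equiv.Perm.sign_eq_prod_prod_Ioi, parityChar_sum, Units.coe_prod]
  refine Finset.prod_congr rfl fun a _ => ?_
  rw [parityChar_sum, Units.coe_prod]
  refine Finset.prod_congr rfl fun b _ => ?_
  by_cases h : π a < π b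
  · rw [if_pos h, parityChar_parityInd_of_false (not_not.2 h)]; rfl
  · rw [if_neg h, parityChar_parityInd_of_true h]; rfl

/-! ### Crossing pairs of edges -/

/-- The arcs `e` and `f`, drawn above a line that carries the vertices, cross, and `e` starts
first. -/
def Crosses {V : Type*} [LinearOrder V] (e f : Sym2 V) : Prop :=
  e.inf < f.inf ∧ f.inf < e.sup ∧ e.sup < f.sup

theorem not_crosses_self {V : Type*} [LinearOrder V] (e : Sym2 V) : ¬ Crosses e e :=
  fun h => lt_irrefl _ h.1

theorem crosses_add_crosses {V : Type*} [LinearOrder V] {s t u v : V} (hsu : s ≠ u) (hsv : s ≠ v)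
    (htu : t ≠ u) (htv : t ≠ v) :
    parityInd (Crosses s(s, t) s(u, v)) + parityInd (Crosses s(u, v) s(s, t)) =
      parityInd (s < u) + parityInd (s < v) + parityInd (t < u) + parityInd (t < v) := by
  simp only [Crosses, Sym2.inf_mk, Sym2.sup_mk]
  rcases le_total s t with h1 | h1 <;> rcases le_total u v with h2 | h2 <;>
  simp only [inf_of_le_left, inf_of_le_right, sup_of_le_left, sup_of_le_right, h1, h2] <;>
  rcases lt_or_gt_of_ne hsu with h3 | h3 <;> rcases lt_or_gt_of_ne hsv with h4 | h4 <;>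
  rcases lt_or_gt_of_ne htu with h5 | h5 <;> rcases lt_or_gt_of_ne htv with h6 | h6 <;>
  first
  | (exfalso; order)
  | (simp only [parityInd, h3, h4, h5, h6, h3.not_gt, h4.not_gt, h5.not_gt, h6.not_gt]; decide)

/-- The vertices `r 0 < s 0 < r 1 < s 1 < ⋯`. -/
structure Interlaced {V : Type*} [LinearOrder V] {n : ℕ} (r s : Fin n → V) : Prop where
  left_lt_left : ∀ a b, r a < r b ↔ a < b
  left_lt_right : ∀ a b, r a < s b ↔ a ≤ b
  right_lt_left : ∀ a b, s a < r b ↔ a < b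
  right_lt_right : ∀ a b, s a < s b ↔ a < b

namespace Interlaced

variable {V : Type*} [LinearOrder V] {n : ℕ} {r s : Fin n → V}

theorem left_injective (h : Interlaced r s) : Function.Injective r := fun a b hab => by
  have h1 := h.left_lt_left a b
  have h2 := h.left_lt_left b a
  rw [hab, lt_self_iff_false, false_iff, not_lt] at h1 h2
  exact le_antisymm h2 h1

theorem right_injective (h : Interlaced r s) : Function.Injective s := fun a b hab => by
  have h1 := h.right_lt_right a b
  have h2 := h.right_lt_right b a
  rw [hab, lt_self_iff_false, false_iff, not_lt] at h1 h2
  exact le_antisymm h2 h1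

theorem left_ne_right (h : Interlaced r s) (a b : Fin n) : r a ≠ s b := fun hab => by
  have h1 := h.left_lt_right a b
  have h2 := h.right_lt_left b a
  rw [hab, lt_self_iff_false, false_iff] at h1 h2
  omega

theorem crosses_add_crosses (h : Interlaced r s) (π : Equiv.Perm (Fin n)) {a b : Fin n}
    (hab : a ≠ b) :
    parityInd (Crosses s(r a, s (π a)) s(r b, s (π b))) +
        parityInd (Crosses s(r b, s (π b)) s(r a, s (π a))) =
      parityInd (a < b) + parityInd (a ≤ π b) + parityInd (π a < b) + parityInd (π a < π b) := by
  rw [_root_.crosses_add_crosses (h.left_injective.ne hab) (h.left_ne_right _ _)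
    (h.left_ne_right _ _).symm (h.right_injective.ne (π.injective.ne hab)),
    h.left_lt_left, h.left_lt_right, h.right_lt_left, h.right_lt_right]

end Interlaced

theorem sum_sum_eq_sum_Ioi_add {n : ℕ} {M : Type*} [AddCommMonoid M] (f : Fin n → Fin n → M) :
    ∑ a, ∑ b, f a b = ∑ a, f a a + ∑ a, ∑ b ∈ Finset.Ioi a, (f a b + f b a) := by
  rw [Finset.sum_sum_Ioi_add_eq_sum_sum_off_diag (fun b a => f a b), ← Finset.sum_add_distrib]
  refine Finset.sum_congr rfl fun a _ => ?_
  rw [← Finset.sum_add_sum_compl {a}, Finset.sum_singleton]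

theorem Interlaced.sum_crosses {V : Type*} [LinearOrder V] {n : ℕ} {r s : Fin n → V}
    (h : Interlaced r s) (π : Equiv.Perm (Fin n)) :
    ∑ a, ∑ b, parityInd (Crosses s(r a, s (π a)) s(r b, s (π b))) =
      ∑ a, ∑ b ∈ Finset.Ioi a, parityInd (¬ π a < π b) + ∑ a, parityInd (π a < a) := by
  have key : ∑ a, ∑ b ∈ Finset.Ioi a, (parityInd (a ≤ π b) + parityInd (b ≤ π a))
      + ∑ a, parityInd (a ≤ π a) = ∑ a : Fin n, ∑ b ∈ Finset.Ioi a, 1 + ∑ a : Fin n, 1 := by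
    rw [add_comm, ← sum_sum_eq_sum_Ioi_add fun a b => parityInd (a ≤ π b)]
    have : ∀ a, ∑ b, parityInd (a ≤ π b) = ∑ b, parityInd (a ≤ b) := fun a =>
      Equiv.sum_comp π fun b => parityInd (a ≤ b)
    simp_rw [this]
    rw [sum_sum_eq_sum_Ioi_add, add_comm]
    congr 1
    · refine Finset.sum_congr rfl fun a _ => Finset.sum_congr rfl fun b hb => ?_
      rw [Finset.mem_Ioi] at hb
      rw [parityInd_true hb.le, parityInd_false hb.not_ge, add_zero]
    · exact Finset.sum_congr rfl fun a _ => parityInd_true le_rfl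
  rw [sum_sum_eq_sum_Ioi_add, Finset.sum_eq_zero fun a _ => parityInd_false (not_crosses_self _),
    zero_add]
  have h1 : ∀ a, ∑ b ∈ Finset.Ioi a, (parityInd (Crosses s(r a, s (π a)) s(r b, s (π b))) +
        parityInd (Crosses s(r b, s (π b)) s(r a, s (π a)))) =
      ∑ b ∈ Finset.Ioi a, parityInd (¬ π a < π b)
      + (∑ b ∈ Finset.Ioi a, (parityInd (a ≤ π b) + parityInd (b ≤ π a))
        + ∑ b ∈ Finset.Ioi a, 1) := fun a => by
    rw [← Finset.sum_add_distrib, ← Finset.sum_add_distrib]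
    refine Finset.sum_congr rfl fun b hb => ?_
    rw [Finset.mem_Ioi] at hb
    rw [h.crosses_add_crosses π hb.ne, parityInd_true hb, parityInd_not,
      ← not_le (a := b), parityInd_not]
    ring
  have h2 : ∑ a, parityInd (π a < a) = ∑ a : Fin n, 1 + ∑ a, parityInd (a ≤ π a) := by
    rw [← Finset.sum_add_distrib]
    refine Finset.sum_congr rfl fun a _ => ?_
    rw [← not_le, parityInd_not]
  rw [Finset.sum_congr rfl fun a _ => h1 a, Finset.sum_add_distrib, Finset.sum_add_distrib, h2]
  congr 1
  rw [← eq_sub_iff_add_eq] at key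
  rw [key]
  simp only [CharTwo.sub_eq_add]
  linear_combination (zmod_two_add_self (∑ a : Fin n, ∑ b ∈ Finset.Ioi a, 1))

theorem Interlaced.parityChar_sum_crosses {V : Type*} [LinearOrder V] {n : ℕ} {r s : Fin n → V}
    (h : Interlaced r s) (π : Equiv.Perm (Fin n)) :
    parityChar (∑ a, ∑ b, parityInd (Crosses s(r a, s (π a)) s(r b, s (π b)))) =
      ((Equiv.Perm.sign π : ℤˣ) : ℤ) * ∏ a, if r a < s (π a) then 1 else -1 := by
  rw [h.sum_crosses, parityChar_add, sign_eq_parityChar,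
    parityChar_sum _ fun a => parityInd (π a < a)]
  congr 1
  refine Finset.prod_congr rfl fun a _ => ?_
  by_cases ha : a ≤ π a
  · rw [if_pos ((h.left_lt_right _ _).2 ha), parityChar_parityInd_of_false ha.not_gt]
  · rw [if_neg fun hh => ha ((h.left_lt_right _ _).1 hh),
      parityChar_parityInd_of_true (not_le.1 ha)]

/-- Every edge of a perfect matching crosses an even number of edges of the matching, if the
colour classes alternate along the line. -/
theorem Interlaced.sum_crosses_add_crosses {V : Type*} [LinearOrder V] {n : ℕ} {r s : Fin n → V}
    (h : Interlaced r s) (π : Equiv.Perm (Fin n)) (a : Fin n) :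
    ∑ b, (parityInd (Crosses s(r a, s (π a)) s(r b, s (π b))) +
        parityInd (Crosses s(r b, s (π b)) s(r a, s (π a)))) = 0 := by
  have h1 : ∀ b, parityInd (Crosses s(r a, s (π a)) s(r b, s (π b))) +
        parityInd (Crosses s(r b, s (π b)) s(r a, s (π a))) =
      (parityInd (a < b) + parityInd (π a < b))
        + (parityInd (a ≤ π b) + parityInd (π a < π b)) + if b = a then 1 else 0 := fun b => by
    by_cases hb : b = a
    · subst hb
      rw [parityInd_false (not_crosses_self _), parityInd_false (lt_irrefl _),
        parityInd_false (lt_irrefl (π b)), if_pos rfl, ← not_le, parityInd_not]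
      linear_combination - zmod_two_add_self (1 + parityInd (b ≤ π b))
    · rw [h.crosses_add_crosses π (Ne.symm hb), if_neg hb]
      ring
  rw [Finset.sum_congr rfl fun b _ => h1 b, Finset.sum_add_distrib, Finset.sum_add_distrib,
    Equiv.sum_comp π fun b => parityInd (a ≤ b) + parityInd (π a < b),
    ← Finset.sum_add_distrib, ← Finset.sum_add_distrib]
  refine Finset.sum_eq_zero fun b _ => ?_
  have h2 : parityInd (a ≤ b) = parityInd (a < b) + if b = a then 1 else 0 := by
    rcases lt_trichotomy a b with hb | hb | hb
    · rw [parityInd_true hb.le, parityInd_true hb, if_neg hb.ne', add_zero]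
    · rw [parityInd_true hb.le, parityInd_false hb.not_lt, if_pos hb.symm, zero_add]
    · rw [parityInd_false hb.not_ge, parityInd_false hb.not_gt, if_neg hb.ne, add_zero]
  rw [h2]
  linear_combination zmod_two_add_self (parityInd (a < b)) + zmod_two_add_self
    (parityInd (π a < b)) + zmod_two_add_self (if b = a then 1 else 0)

/-- Parity of the number of crossing pairs in a set of edges. -/
noncomputable def crossingParity {V : Type*} [LinearOrder V] (P : Finset (Sym2 V)) : ZMod 2 :=
  ∑ e ∈ P, ∑ f ∈ P, parityInd (Crosses e f)

/-! ### Perfect matchings as permutations -/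

open scoped Classical in
/-- The set of edges `{r a, s (π a)}`. -/
noncomputable def matchingOf {ι V : Type*} [Fintype ι] (r s : ι → V) (π : Equiv.Perm ι) :
    Finset (Sym2 V) :=
  Finset.univ.image fun a => s(r a, s (π a))

theorem matchingEdge_injective {ι V : Type*} {r s : ι → V} (hr : Function.Injective r) (hrs : ∀ a b, r a ≠ s b)
    (π : Equiv.Perm ι) : Function.Injective fun a => s(r a, s (π a)) := fun a b hab => by
  rcases Sym2.eq_iff.1 hab with h | h
  · exact hr h.1
  · exact absurd h.1 (hrs _ _)

section Matching

variable {ι V : Type*} [Fintype ι] {r s : ι → V} {G : SimpleGraph V}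

@[to_additive]
theorem prod_matchingOf (hr : Function.Injective r) (hrs : ∀ a b, r a ≠ s b)
    (π : Equiv.Perm ι) {M : Type*} [CommMonoid M] (g : Sym2 V → M) :
    ∏ e ∈ matchingOf r s π, g e = ∏ a, g s(r a, s (π a)) := by
  classical
  rw [matchingOf, Finset.prod_image fun a _ b _ h => matchingEdge_injective hr hrs π h]

theorem mem_matchingOf {π : Equiv.Perm ι} {e : Sym2 V} :
    e ∈ matchingOf r s π ↔ ∃ a, s(r a, s (π a)) = e := by
  simp [matchingOf]

theorem matchingOf_injective (hr : Function.Injective r) (hs : Function.Injective s)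
    (hrs : ∀ a b, r a ≠ s b) : Function.Injective (matchingOf r s) := fun π π' h => by
  ext a
  have : s(r a, s (π a)) ∈ matchingOf r s π' := h ▸ mem_matchingOf.2 ⟨a, rfl⟩
  obtain ⟨b, hb⟩ := mem_matchingOf.1 this
  rcases Sym2.eq_iff.1 hb with h | h
  · rw [← hs h.2, hr h.1]
  · exact absurd h.1 (hrs _ _)

theorem isDimer_matchingOf (hr : Function.Injective r) (hs : Function.Injective s)
    (hrs : ∀ a b, r a ≠ s b) (hcov : ∀ v, (∃ a, r a = v) ∨ ∃ a, s a = v) {π : Equiv.Perm ι}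
    (hπ : ∀ a, G.Adj (r a) (s (π a))) : IsDimer G (matchingOf r s π) := by
  refine ⟨fun e he => ?_, fun v => ?_⟩
  · obtain ⟨a, rfl⟩ := mem_matchingOf.1 he
    exact hπ a
  · rcases hcov v with ⟨a, rfl⟩ | ⟨a, rfl⟩
    · refine ⟨s(r a, s (π a)), ⟨mem_matchingOf.2 ⟨a, rfl⟩, Sym2.mem_mk_left _ _⟩, ?_⟩
      rintro e ⟨he, hv⟩
      obtain ⟨b, rfl⟩ := mem_matchingOf.1 he
      rcases Sym2.mem_iff.1 hv with h | h
      · rw [hr h]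
      · exact absurd h (hrs _ _)
    · refine ⟨s(r (π.symm a), s a), ⟨mem_matchingOf.2 ⟨π.symm a, by simp⟩,
        Sym2.mem_mk_right _ _⟩, ?_⟩
      rintro e ⟨he, hv⟩
      obtain ⟨b, rfl⟩ := mem_matchingOf.1 he
      rcases Sym2.mem_iff.1 hv with h | h
      · exact absurd h.symm (hrs _ _)
      · rw [hs h]; simp

theorem exists_matchingOf_eq (hr : Function.Injective r) (hrs : ∀ a b, r a ≠ s b)
    (hcov : ∀ v, (∃ a, r a = v) ∨ ∃ a, s a = v)
    (hl : ∀ a b, ¬ G.Adj (r a) (r b)) (hr' : ∀ a b, ¬ G.Adj (s a) (s b))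
    {P : Finset (Sym2 V)} (hP : IsDimer G P) :
    ∃ π : Equiv.Perm ι, (∀ a, G.Adj (r a) (s (π a))) ∧ matchingOf r s π = P := by
  have h1 : ∀ a, ∃ b, s(r a, s b) ∈ P := fun a => by
    obtain ⟨e, ⟨he, hv⟩, -⟩ := hP.2 (r a)
    obtain ⟨w, rfl⟩ := Sym2.mem_iff_exists.1 hv
    rcases hcov w with ⟨b, rfl⟩ | ⟨b, rfl⟩
    · exact absurd (hP.1 _ he) (hl a b)
    · exact ⟨b, he⟩
  choose f hf using h1
  have hinj : Function.Injective f := fun a b hab => by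
    have := (hP.2 (s (f a))).unique ⟨hf a, Sym2.mem_mk_right _ _⟩
      ⟨hf b, by rw [hab]; exact Sym2.mem_mk_right _ _⟩
    rcases Sym2.eq_iff.1 this with h | h
    · exact hr h.1
    · exact absurd h.1 (hrs _ _)
  refine ⟨Equiv.ofBijective f (Finite.injective_iff_bijective.1 hinj), fun a => hP.1 _ (hf a), ?_⟩
  ext e
  rw [mem_matchingOf]
  constructor
  · rintro ⟨a, rfl⟩
    exact hf a
  · intro he
    have h2 : ∃ a, r a ∈ e := by
      induction e with
      | _ u w =>
        rcases hcov u with ⟨a, rfl⟩ | ⟨a, rfl⟩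
        · exact ⟨a, Sym2.mem_mk_left _ _⟩
        · rcases hcov w with ⟨b, rfl⟩ | ⟨b, rfl⟩
          · exact ⟨b, Sym2.mem_mk_right _ _⟩
          · exact absurd (hP.1 _ he) (hr' a b)
    obtain ⟨a, ha⟩ := h2
    exact ⟨a, (hP.2 (r a)).unique ⟨hf a, Sym2.mem_mk_left _ _⟩ ⟨he, ha⟩⟩

open scoped Classical in
theorem sum_isDimer [DecidableEq ι] [Fintype V] (hr : Function.Injective r)
    (hs : Function.Injective s)
    (hrs : ∀ a b, r a ≠ s b) (hcov : ∀ v, (∃ a, r a = v) ∨ ∃ a, s a = v)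
    (hl : ∀ a b, ¬ G.Adj (r a) (r b)) (hr' : ∀ a b, ¬ G.Adj (s a) (s b))
    {M : Type*} [AddCommMonoid M] (g : Finset (Sym2 V) → M) :
    ∑ P : Finset (Sym2 V) with IsDimer G P, g P =
      ∑ π : Equiv.Perm ι with ∀ a, G.Adj (r a) (s (π a)), g (matchingOf r s π) := by
  rw [← Finset.sum_image fun π _ π' _ h => matchingOf_injective hr hs hrs h]
  refine Finset.sum_congr ?_ fun _ _ => rfl
  ext P
  simp only [Finset.mem_filter, Finset.mem_univ, true_and, Finset.mem_image]
  constructor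
  · exact exists_matchingOf_eq hr hrs hcov hl hr'
  · rintro ⟨π, hπ, rfl⟩
    exact isDimer_matchingOf hr hs hrs hcov hπ

end Matching

/-! ### Gauss sums of bilinear forms modulo `2` -/

section GaussSum

open Matrix

variable {ι : Type*} [Fintype ι] [DecidableEq ι]

theorem sum_parityChar_dotProduct (w : ι → ZMod 2) :
    ∑ y : ι → ZMod 2, parityChar (y ⬝ᵥ w) = if w = 0 then 2 ^ Fintype.card ι else 0 := by
  have h : ∀ y : ι → ZMod 2, parityChar (y ⬝ᵥ w) = ∏ i, parityChar (y i * w i) := fun y =>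
    parityChar_sum _ _
  have h2 : ∀ b : ZMod 2, ∑ a : ZMod 2, parityChar (a * b) = if b = 0 then 2 else 0 := by decide
  simp_rw [h]
  rw [← Fintype.piFinset_univ, Finset.sum_prod_piFinset Finset.univ
    fun i a => parityChar (a * w i)]
  simp_rw [h2]
  split_ifs with hw
  · subst hw
    simp
  · obtain ⟨i, hi⟩ := Function.ne_iff.1 hw
    exact Finset.prod_eq_zero (Finset.mem_univ i) (if_neg hi)

theorem sum_sum_parityChar_bilinear {A B : Matrix ι ι (ZMod 2)} (hAB : A * B = 1)
    (p r : ι → ZMod 2) :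
    ∑ y : ι → ZMod 2, ∑ z : ι → ZMod 2, parityChar (y ⬝ᵥ A *ᵥ z + (y ⬝ᵥ p + z ⬝ᵥ r)) =
      2 ^ Fintype.card ι * parityChar (r ⬝ᵥ B *ᵥ p) := by
  have hBA : B * A = 1 := mul_eq_one_comm.1 hAB
  rw [Finset.sum_comm]
  have h : ∀ z y : ι → ZMod 2, parityChar (y ⬝ᵥ A *ᵥ z + (y ⬝ᵥ p + z ⬝ᵥ r)) =
      parityChar (y ⬝ᵥ (A *ᵥ z + p)) * parityChar (z ⬝ᵥ r) := fun z y => by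
    rw [← parityChar_add, dotProduct_add, add_assoc]
  have h0 : ∀ z : ι → ZMod 2, A *ᵥ z + p = 0 ↔ z = B *ᵥ p := fun z => by
    constructor
    · intro hz
      have h1 : A *ᵥ z = p := by
        funext i
        exact zmod_two_eq_of_add_eq_zero (congrFun hz i)
      rw [← h1, mulVec_mulVec, hBA, one_mulVec]
    · rintro rfl
      rw [mulVec_mulVec, hAB, one_mulVec]
      funext i
      exact zmod_two_add_self (p i)
  simp_rw [h, ← Finset.sum_mul, sum_parityChar_dotProduct, h0, ite_mul, zero_mul]
  rw [Finset.sum_ite_eq' Finset.univ, if_pos (Finset.mem_univ _), dotProduct_comm]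

theorem sum_sum_parityChar_linear (p r : ι → ZMod 2) :
    ∑ y : ι → ZMod 2, ∑ z : ι → ZMod 2, parityChar (y ⬝ᵥ p + z ⬝ᵥ r) =
      if p = 0 ∧ r = 0 then 2 ^ Fintype.card ι * 2 ^ Fintype.card ι else 0 := by
  simp_rw [parityChar_add]
  rw [← Finset.sum_mul_sum, sum_parityChar_dotProduct, sum_parityChar_dotProduct]
  by_cases hp : p = 0 <;> by_cases hr : r = 0 <;> simp [hp, hr]

/-- Fourier transform of the zero set of a nondegenerate bilinear form modulo `2`. -/
theorem two_mul_sum_filter_bilinear {A B : Matrix ι ι (ZMod 2)} (hAB : A * B = 1)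
    (p r : ι → ZMod 2) :
    2 * ∑ x : (ι → ZMod 2) × (ι → ZMod 2) with x.1 ⬝ᵥ A *ᵥ x.2 = 0,
        parityChar (x.1 ⬝ᵥ p + x.2 ⬝ᵥ r) =
      2 ^ Fintype.card ι * ((if p = 0 ∧ r = 0 then 2 ^ Fintype.card ι else 0)
        + parityChar (r ⬝ᵥ B *ᵥ p)) := by
  have h : ∀ a b : ZMod 2,
      2 * (if a = 0 then parityChar b else 0) = parityChar b + parityChar (a + b) := by decide
  rw [Finset.sum_filter, Finset.mul_sum, mul_add, ← sum_sum_parityChar_bilinear hAB, mul_ite,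
    mul_zero, ← sum_sum_parityChar_linear, Fintype.sum_prod_type]
  dsimp only
  rw [← Finset.sum_add_distrib]
  refine Finset.sum_congr rfl fun y _ => ?_
  rw [← Finset.sum_add_distrib]
  exact Finset.sum_congr rfl fun z _ => h _ _

end GaussSum

/-! ### The matrix of the quadratic form and its inverse -/

section FormMatrix

open Matrix Kronecker

/-- The lower triangular matrix of ones. -/
noncomputable def lowerOnes (c : ℕ) : Matrix (Fin c) (Fin c) (ZMod 2) :=
  Matrix.of fun i j => parityInd ((j : ℕ) ≤ i)

/-- The matrix with ones on the diagonal and just below it. -/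
noncomputable def lowerBidiagonal (c : ℕ) : Matrix (Fin c) (Fin c) (ZMod 2) :=
  Matrix.of fun i j => parityInd ((i : ℕ) = j ∨ (i : ℕ) = j + 1)

theorem lowerOnes_mul_lowerBidiagonal (c : ℕ) : lowerOnes c * lowerBidiagonal c = 1 := by
  ext i j
  have h1 : ∀ x : Fin c, lowerOnes c i x * lowerBidiagonal c x j =
      (if x = j then parityInd ((j : ℕ) ≤ i) else 0) +
        if (x : ℕ) = j + 1 then parityInd ((j : ℕ) + 1 ≤ i) else 0 := fun x => by
    simp only [lowerOnes, lowerBidiagonal, Matrix.of_apply, ← parityInd_and]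
    by_cases hx : x = j
    · subst hx
      simp
    · rw [if_neg hx, zero_add]
      split_ifs with h2
      · rw [h2]; simp
      · apply parityInd_false
        rw [Fin.ext_iff] at hx
        tauto
  rw [Matrix.mul_apply, Finset.sum_congr rfl fun x _ => h1 x, Finset.sum_add_distrib,
    Finset.sum_ite_eq' Finset.univ, if_pos (Finset.mem_univ _)]
  have h2 : (∑ x : Fin c, if (x : ℕ) = j + 1 then parityInd ((j : ℕ) + 1 ≤ i) else 0) =
      parityInd ((j : ℕ) + 1 ≤ i) := by
    by_cases hj : (j : ℕ) + 1 < c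
    · rw [Finset.sum_eq_single ⟨(j : ℕ) + 1, hj⟩, if_pos rfl]
      · intro x _ hx
        exact if_neg fun h => hx (Fin.ext h)
      · simp
    · rw [parityInd_false (by omega)]
      simp
  rw [h2, Matrix.one_apply]
  rcases lt_trichotomy (i : ℕ) j with h | h | h
  · rw [parityInd_false (by omega), parityInd_false (by omega),
      if_neg (by rw [Fin.ext_iff]; omega)]
    rfl
  · rw [parityInd_true (by omega), parityInd_false (by omega), if_pos (Fin.ext h)]
    rfl
  · rw [parityInd_true (by omega), parityInd_true (by omega),
      if_neg (by rw [Fin.ext_iff]; omega)]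
    rfl

/-- Positions in a family of rectangular layers; layer `l` has `c l` columns and `n l` rows. -/
abbrev LayerIndex {Λ : Type*} (c n : Λ → ℕ) : Type _ := Σ l, Fin (c l) × Fin (n l)

variable {Λ : Type*} [DecidableEq Λ] (c n : Λ → ℕ)

/-- The matrix of the quadratic form that counts the pairs of negative edges. -/
noncomputable def formMatrix : Matrix (LayerIndex c n) (LayerIndex c n) (ZMod 2) :=
  blockDiagonal' fun l => lowerOnes (c l) ⊗ₖ (lowerBidiagonal (n l))ᵀ

/-- The inverse of `formMatrix`. -/
noncomputable def formMatrixInv : Matrix (LayerIndex c n) (LayerIndex c n) (ZMod 2) :=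
  blockDiagonal' fun l => lowerBidiagonal (c l) ⊗ₖ (lowerOnes (n l))ᵀ

theorem formMatrix_mul_formMatrixInv [Fintype Λ] : formMatrix c n * formMatrixInv c n = 1 := by
  rw [formMatrix, formMatrixInv, ← blockDiagonal'_mul, ← blockDiagonal'_one]
  congr 1
  funext l
  rw [← mul_kronecker_mul, lowerOnes_mul_lowerBidiagonal, ← transpose_mul,
    lowerOnes_mul_lowerBidiagonal, transpose_one, one_kronecker_one]
  rfl

theorem formMatrix_apply (i j : LayerIndex c n) :
    formMatrix c n i j = parityInd (i.1 = j.1 ∧ (j.2.1 : ℕ) ≤ i.2.1 ∧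
      ((j.2.2 : ℕ) = i.2.2 ∨ (j.2.2 : ℕ) = i.2.2 + 1)) := by
  obtain ⟨l, a, v⟩ := i
  obtain ⟨l', a', v'⟩ := j
  by_cases h : l = l'
  · subst h
    simp [formMatrix, lowerOnes, lowerBidiagonal, blockDiagonal'_apply_eq, ← parityInd_and]
  · rw [formMatrix, blockDiagonal'_apply_ne _ _ _ h, parityInd_false fun h' => h h'.1]

theorem formMatrixInv_apply (i j : LayerIndex c n) :
    formMatrixInv c n i j = parityInd (i.1 = j.1 ∧
      ((i.2.1 : ℕ) = j.2.1 ∨ (i.2.1 : ℕ) = j.2.1 + 1) ∧ (i.2.2 : ℕ) ≤ j.2.2) := by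
  obtain ⟨l, a, v⟩ := i
  obtain ⟨l', a', v'⟩ := j
  by_cases h : l = l'
  · subst h
    simp [formMatrixInv, lowerOnes, lowerBidiagonal, blockDiagonal'_apply_eq, ← parityInd_and]
  · rw [formMatrixInv, blockDiagonal'_apply_ne _ _ _ h, parityInd_false fun h' => h h'.1]

end FormMatrix

/-- If every element has even total interaction, then so has any subset with its complement. -/
theorem sum_filter_interaction_eq_zero {α : Type*} (T : Finset α) (b : α → Prop) [DecidablePred b]
    (x : α → α → ZMod 2) (h : ∀ i ∈ T, ∑ j ∈ T, (x i j + x j i) = 0) :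
    ∑ i ∈ T with b i, ∑ j ∈ T with ¬ b j, (x i j + x j i) = 0 := by
  have h1 : ∑ i ∈ T with b i, ∑ j ∈ T, (x i j + x j i) = 0 :=
    Finset.sum_eq_zero fun i hi => h i (Finset.mem_filter.1 hi).1
  have h2 : ∑ i ∈ T with b i, ∑ j ∈ T with b j, (x i j + x j i) = 0 := by
    simp_rw [Finset.sum_add_distrib]
    rw [Finset.sum_comm (f := fun i j => x j i), zmod_two_add_self]
  rw [Finset.sum_congr rfl fun i _ => (Finset.sum_filter_add_sum_filter_not T b _).symm,
    Finset.sum_add_distrib, h2, zero_add] at h1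
  exact h1

namespace Site

variable {m₁ m₂ k : ℕ}

theorem lt_iff_pos_lt {u v : Site m₁ m₂ k} : u < v ↔ u.pos < v.pos := Iff.rfl

theorem column_lt (u : Site m₁ m₂ k) : u.column < m₁ * m₂ := by
  have hx := u.x.isLt
  have hy := u.y.isLt
  have h1 : (u.x + 1 : ℕ) * m₂ ≤ m₁ * m₂ := Nat.mul_le_mul_right _ hx
  rw [Nat.add_mul] at h1
  unfold column
  split_ifs <;> omega

theorem pos_lt (u : Site m₁ m₂ k) : u.pos < m₁ * m₂ * k := by
  have h1 := u.height_lt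
  have h2 : (u.column + 1) * k ≤ m₁ * m₂ * k := Nat.mul_le_mul_right _ u.column_lt
  rw [Nat.add_mul] at h2
  unfold pos
  omega

theorem even_column (hm₂ : Odd m₂) (u : Site m₁ m₂ k) :
    Even u.column ↔ Even ((u.x : ℕ) + u.y) := by
  have hy := u.y.isLt
  unfold column
  split_ifs with h
  · simp [Nat.even_add, h]
  · have : Even (m₂ - 1 - u.y) ↔ Even (u.y : ℕ) := by
      rw [Nat.even_sub (by omega), Nat.even_sub (by omega)]
      simp [Nat.not_even_iff_odd.2 hm₂]
    rw [Nat.even_add, Nat.even_add, Nat.even_mul, this]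
    simp [h, Nat.not_even_iff_odd.2 hm₂]

theorem even_pos (hm₂ : Odd m₂) (hk : Even k) (u : Site m₁ m₂ k) :
    Even u.pos ↔ Even ((u.x : ℕ) + u.y + u.z) := by
  have hz := u.z.isLt
  rw [pos, Nat.even_add, Nat.even_mul, Nat.even_add (n := u.z), ← even_column hm₂, height]
  split_ifs with h
  · simp [hk, h]
  · rw [Nat.even_sub (by omega), Nat.even_sub (by omega)]
    simp [hk, h]

end Site

namespace CubicLattice

variable {m₁ m₂ k : ℕ}

/-! ### Layers as grids -/

/-- The layers: `none` is the layer `H`, and `some x` is the layer `W_x`. -/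
noncomputable def layerEdges (m₁ m₂ k : ℕ) : Option (Fin m₁) → Finset (Sym2 (Site m₁ m₂ k))
  | none => horizontalEdges m₁ m₂ k
  | some x => widthEdges m₁ m₂ k x

/-- Number of columns of vertices in the drawing of a layer. -/
def layerWidth (m₁ m₂ : ℕ) : Option (Fin m₁) → ℕ
  | none => m₁
  | some _ => m₂

/-- Number of rows in the drawing of a layer. -/
def layerRows (m₁ m₂ k : ℕ) : Option (Fin m₁) → ℕ
  | none => m₂ * k
  | some _ => k

/-- Position of the smallest vertex of a layer. -/
def layerBase (m₁ m₂ k : ℕ) : Option (Fin m₁) → ℕ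
  | none => 0
  | some x => x * (m₂ * k)

/-- Half the number of columns of edges in the drawing of a layer. -/
def layerCols (m₁ m₂ : ℕ) (l : Option (Fin m₁)) : ℕ := (layerWidth m₁ m₂ l - 1) / 2

/-- Horizontal coordinate in the drawing of a layer. -/
def hCoord : Option (Fin m₁) → Site m₁ m₂ k → ℕ
  | none => hCoordH
  | some _ => hCoordW

/-- Vertical coordinate in the drawing of a layer. -/
def vCoord : Option (Fin m₁) → Site m₁ m₂ k → ℕ
  | none => vCoordH
  | some _ => vCoordW

/-- Place of the grid point in column `h` and row `v` on the snake through a grid with `n` rows. -/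
def snake (n h v : ℕ) : ℕ := h * n + if Even h then v else n - 1 - v

/-- The vertex in column `h` and row `v` (counted from `0`) of the drawing of `H`. -/
def gridSiteH (h : Fin m₁) (v : Fin (m₂ * k)) : Site m₁ m₂ k where
  x := h
  y := ⟨v / k, Nat.div_lt_of_lt_mul (v.isLt.trans_eq (mul_comm _ _))⟩
  z := ⟨if Even ((v : ℕ) / k) then v % k else k - 1 - v % k, by
    have : (v : ℕ) % k < k := v.modNat.isLt
    split_ifs <;> omega⟩

/-- The vertex in column `h` and row `v` (counted from `0`) of the drawing of `W_x`. -/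
def gridSiteW (x : Fin m₁) (h : Fin m₂) (v : Fin k) : Site m₁ m₂ k where
  x := x
  y := ⟨if Even (x : ℕ) then h else m₂ - 1 - h, by split_ifs <;> omega⟩
  z := ⟨if Even (x : ℕ) then v else k - 1 - v, by split_ifs <;> omega⟩

/-- The vertex in column `h` and row `v` (counted from `0`) of the drawing of a layer. -/
def gridSite : (l : Option (Fin m₁)) → Fin (layerWidth m₁ m₂ l) → Fin (layerRows m₁ m₂ k l) →
    Site m₁ m₂ k
  | none => gridSiteH
  | some x => gridSiteW x

theorem pos_gridSiteH (hm₂ : Odd m₂) (h : Fin m₁) (v : Fin (m₂ * k)) :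
    (gridSiteH h v).pos = snake (m₂ * k) h v := by
  have hy : (v : ℕ) / k < m₂ := (gridSiteH h v).y.isLt
  have hw : (v : ℕ) % k < k := v.modNat.isLt
  have hv : (v : ℕ) / k * k + v % k = v := Nat.div_add_mod' _ _
  have hc := Site.even_column hm₂ (gridSiteH h v)
  rw [Nat.even_add] at hc
  simp only [Site.pos, Site.height, hc, snake]
  simp only [Site.column, gridSiteH]
  obtain ⟨d, hd⟩ := Nat.exists_eq_add_of_lt hy
  obtain ⟨e, he⟩ := Nat.exists_eq_add_of_lt hw
  have h4 : m₂ * k - 1 - v = d * k + e := by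
    have : m₂ * k = (v : ℕ) / k * k + d * k + k := by
      conv_lhs => rw [hd]
      ring
    omega
  have h1 : m₂ - 1 - (v : ℕ) / k = d := by omega
  have h2 : k - 1 - (v : ℕ) % k = e := by omega
  have h3 : k - 1 - e = (v : ℕ) % k := by omega
  rw [h1, h2, h4]
  by_cases he1 : Even (h : ℕ) <;> by_cases he2 : Even ((v : ℕ) / k) <;>
    simp only [he1, he2, if_true, if_false, iff_true, iff_false, not_true, h2, h3]
  · rw [Nat.add_mul, add_assoc, hv, mul_assoc]
  · rw [Nat.add_mul, add_assoc, hv, mul_assoc]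
  · ring
  · ring

theorem pos_gridSiteW (hm₂ : Odd m₂) (x : Fin m₁) (h : Fin m₂) (v : Fin k) :
    (gridSiteW x h v).pos = x * (m₂ * k) + snake k h v := by
  have hh := h.isLt
  have hv := v.isLt
  have hc := Site.even_column hm₂ (gridSiteW x h v)
  have hp : Even (m₂ - 1 - h) ↔ Even (h : ℕ) := by
    rw [Nat.even_sub (by omega), Nat.even_sub (by omega)]
    simp [Nat.not_even_iff_odd.2 hm₂]
  rw [Nat.even_add] at hc
  simp only [Site.pos, Site.height, hc, snake]
  simp only [Site.column, gridSiteW]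
  have h1 : m₂ - 1 - (m₂ - 1 - h) = h := by omega
  have h2 : k - 1 - (k - 1 - v) = v := by omega
  by_cases he1 : Even (x : ℕ) <;> by_cases he2 : Even (h : ℕ) <;>
    simp only [he1, he2, hp, h1, h2, if_true, if_false,
      iff_true, iff_false, not_true] <;> ring

theorem pos_gridSite (hm₂ : Odd m₂) (l : Option (Fin m₁)) (h : Fin (layerWidth m₁ m₂ l))
    (v : Fin (layerRows m₁ m₂ k l)) :
    (gridSite l h v).pos = layerBase m₁ m₂ k l + snake (layerRows m₁ m₂ k l) h v := by
  cases l with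
  | none => exact (pos_gridSiteH hm₂ h v).trans (Nat.zero_add _).symm
  | some x => exact pos_gridSiteW hm₂ x h v

theorem hCoord_gridSite (l : Option (Fin m₁)) (h : Fin (layerWidth m₁ m₂ l))
    (v : Fin (layerRows m₁ m₂ k l)) : hCoord l (gridSite l h v) = h + 1 := by
  cases l with
  | none => rfl
  | some x =>
    change Fin m₂ at h
    have hh := h.isLt
    change hCoordW (gridSiteW x h v) = h + 1
    simp only [hCoordW, gridSiteW]
    split_ifs <;> omega

theorem vCoord_gridSite (hm₂ : Odd m₂) (l : Option (Fin m₁)) (h : Fin (layerWidth m₁ m₂ l))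
    (v : Fin (layerRows m₁ m₂ k l)) : vCoord l (gridSite l h v) = v + 1 := by
  cases l with
  | none =>
    have h0 : 0 < m₁ := lt_of_le_of_lt (Nat.zero_le _) h.isLt
    change Fin (m₂ * k) at v
    change (gridSiteH ⟨0, h0⟩ v).pos + 1 = v + 1
    rw [pos_gridSiteH hm₂]
    simp [snake]
  | some x =>
    change Fin k at v
    have hv := v.isLt
    change vCoordW (gridSiteW x h v) = v + 1
    simp only [vCoordW, gridSiteW]
    split_ifs <;> omega

theorem snake_lt_snake_succ {n v : ℕ} (h : ℕ) (hv : v < n) : snake n h v < snake n (h + 1) v := by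
  unfold snake
  rw [Nat.add_mul, one_mul]
  split_ifs <;> omega

theorem gridEdge_mem (l : Option (Fin m₁)) {h : ℕ} (hh : h + 1 < layerWidth m₁ m₂ l)
    (v : Fin (layerRows m₁ m₂ k l)) :
    s(gridSite l ⟨h, Nat.lt_of_succ_lt hh⟩ v, gridSite l ⟨h + 1, hh⟩ v) ∈
      layerEdges m₁ m₂ k l := by
  cases l with
  | none =>
    simp only [layerEdges, horizontalEdges, Finset.mem_filter, Finset.mem_univ, true_and]
    exact ⟨_, _, rfl, rfl, rfl, rfl⟩
  | some x =>
    simp only [layerEdges, widthEdges, Finset.mem_filter, Finset.mem_univ, true_and]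
    by_cases hx : Even (x : ℕ)
    · refine ⟨_, _, rfl, rfl, rfl, ?_, rfl⟩
      simp [gridSite, gridSiteW, hx]
    · refine ⟨_, _, Sym2.eq_swap, rfl, rfl, ?_, rfl⟩
      change h + 1 < m₂ at hh
      change (if Even (x : ℕ) then h + 1 else m₂ - 1 - (h + 1)) + 1 =
        if Even (x : ℕ) then h else m₂ - 1 - h
      rw [if_neg hx, if_neg hx]
      omega

/-! ### Enumeration of the edges that are not vertical -/

/-- Indices of half of the edges that are not vertical. -/
abbrev HalfIndex (m₁ m₂ k : ℕ) : Type := LayerIndex (layerCols m₁ m₂) (layerRows m₁ m₂ k)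

/-- Indices of the edges that are not vertical: the left summand contains those whose column number
is even (odd, if counted from `0`). -/
abbrev EdgeIndex (m₁ m₂ k : ℕ) : Type := HalfIndex m₁ m₂ k ⊕ HalfIndex m₁ m₂ k

namespace EdgeIndex

/-- The layer of an edge. -/
def layer : EdgeIndex m₁ m₂ k → Option (Fin m₁) := Sum.elim Sigma.fst Sigma.fst

/-- The column of an edge, counted from `0`. -/
def col : EdgeIndex m₁ m₂ k → ℕ := Sum.elim (fun i => 2 * i.2.1 + 1) fun i => 2 * i.2.1

/-- The row of an edge, counted from `0`. -/
def row : (i : EdgeIndex m₁ m₂ k) → Fin (layerRows m₁ m₂ k i.layer)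
  | Sum.inl i => i.2.2
  | Sum.inr i => i.2.2

theorem col_add_one_lt : ∀ i : EdgeIndex m₁ m₂ k, i.col + 1 < layerWidth m₁ m₂ i.layer
  | Sum.inl i => by
    have := i.2.1.isLt
    simp only [layerCols] at this
    simp only [col, layer, Sum.elim_inl]
    omega
  | Sum.inr i => by
    have := i.2.1.isLt
    simp only [layerCols] at this
    simp only [col, layer, Sum.elim_inr]
    omega

/-- The left vertex of an edge. -/
def fst (i : EdgeIndex m₁ m₂ k) : Site m₁ m₂ k :=
  gridSite i.layer ⟨i.col, Nat.lt_of_succ_lt i.col_add_one_lt⟩ i.row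

/-- The right vertex of an edge. -/
def snd (i : EdgeIndex m₁ m₂ k) : Site m₁ m₂ k :=
  gridSite i.layer ⟨i.col + 1, i.col_add_one_lt⟩ i.row

/-- The edge with a given index. -/
def edge (i : EdgeIndex m₁ m₂ k) : Sym2 (Site m₁ m₂ k) := s(i.fst, i.snd)

theorem fst_lt_snd (hm₂ : Odd m₂) (i : EdgeIndex m₁ m₂ k) : i.fst < i.snd := by
  rw [Site.lt_iff_pos_lt, fst, snd, pos_gridSite hm₂, pos_gridSite hm₂]
  exact Nat.add_lt_add_left (snake_lt_snake_succ _ i.row.isLt) _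

theorem inf_edge (hm₂ : Odd m₂) (i : EdgeIndex m₁ m₂ k) : i.edge.inf = i.fst := by
  rw [edge, Sym2.inf_mk, inf_of_le_left (i.fst_lt_snd hm₂).le]

theorem sup_edge (hm₂ : Odd m₂) (i : EdgeIndex m₁ m₂ k) : i.edge.sup = i.snd := by
  rw [edge, Sym2.sup_mk, sup_of_le_right (i.fst_lt_snd hm₂).le]

theorem edge_mem (i : EdgeIndex m₁ m₂ k) : i.edge ∈ layerEdges m₁ m₂ k i.layer :=
  gridEdge_mem _ _ _

end EdgeIndex

theorem exists_edge_eq (hm₁ : Odd m₁) (hm₂ : Odd m₂) (l : Option (Fin m₁)) {h : ℕ}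
    (hh : h + 1 < layerWidth m₁ m₂ l) (v : Fin (layerRows m₁ m₂ k l)) :
    ∃ i : EdgeIndex m₁ m₂ k,
      i.edge = s(gridSite l ⟨h, Nat.lt_of_succ_lt hh⟩ v, gridSite l ⟨h + 1, hh⟩ v) := by
  have ho : Odd (layerWidth m₁ m₂ l) := by
    cases l
    · exact hm₁
    · exact hm₂
  obtain ⟨c, hc⟩ := ho
  have hlt : h / 2 < layerCols m₁ m₂ l := by
    unfold layerCols
    omega
  rcases Nat.even_or_odd' h with ⟨a, rfl | rfl⟩
  · exact ⟨Sum.inr ⟨l, ⟨a, by omega⟩, v⟩, rfl⟩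
  · exact ⟨Sum.inl ⟨l, ⟨a, by omega⟩, v⟩, rfl⟩

theorem gridSiteW_eq {x : Fin m₁} {u : Site m₁ m₂ k} (hu : u.x = x) {h : Fin m₂} {v : Fin k}
    (hh : (h : ℕ) = if Even (x : ℕ) then (u.y : ℕ) else m₂ - 1 - u.y)
    (hv : (v : ℕ) = if Even (x : ℕ) then (u.z : ℕ) else k - 1 - u.z) :
    gridSiteW x h v = u := by
  have := u.y.isLt
  have := u.z.isLt
  refine Site.ext hu.symm (Fin.ext ?_) (Fin.ext ?_)
  · simp only [gridSiteW]
    split_ifs at hh ⊢ <;> omega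
  · simp only [gridSiteW]
    split_ifs at hv ⊢ <;> omega

theorem gridSiteH_eq (u : Site m₁ m₂ k) {h : Fin m₁} {v : Fin (m₂ * k)} (hh : h = u.x)
    (hv : (v : ℕ) = u.y * k + if Even (u.y : ℕ) then (u.z : ℕ) else k - 1 - u.z) :
    gridSiteH h v = u := by
  have hz := u.z.isLt
  have hlt : (if Even (u.y : ℕ) then (u.z : ℕ) else k - 1 - u.z) < k := by
    split_ifs <;> omega
  have hd : (v : ℕ) / k = u.y := by
    rw [hv, mul_comm, Nat.mul_add_div (by omega), Nat.div_eq_of_lt hlt, add_zero]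
  have hm : (v : ℕ) % k = if Even (u.y : ℕ) then (u.z : ℕ) else k - 1 - u.z := by
    rw [hv, mul_comm, Nat.mul_add_mod, Nat.mod_eq_of_lt hlt]
  refine Site.ext hh (Fin.ext hd) (Fin.ext ?_)
  simp only [gridSiteH, hd]
  split_ifs at hm ⊢ <;> omega

theorem mem_range_edge (hm₁ : Odd m₁) (hm₂ : Odd m₂) {l : Option (Fin m₁)}
    {e : Sym2 (Site m₁ m₂ k)} (he : e ∈ layerEdges m₁ m₂ k l) :
    ∃ i : EdgeIndex m₁ m₂ k, i.edge = e := by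
  cases l with
  | none =>
    simp only [layerEdges, horizontalEdges, Finset.mem_filter, Finset.mem_univ, true_and] at he
    obtain ⟨u, v, rfl, hx, hy, hz⟩ := he
    have hux := u.x.isLt
    have hvx := v.x.isLt
    have huy := u.y.isLt
    have huz := u.z.isLt
    have hlt : u.y * k + (if Even (u.y : ℕ) then (u.z : ℕ) else k - 1 - u.z) < m₂ * k := by
      have : (u.y + 1 : ℕ) * k ≤ m₂ * k := Nat.mul_le_mul_right _ huy
      rw [Nat.add_mul] at this
      split_ifs <;> omega
    obtain ⟨i, hi⟩ := exists_edge_eq hm₁ hm₂ none (h := u.x) (hx ▸ hvx : (u.x : ℕ) + 1 < m₁)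
      (⟨_, hlt⟩ : Fin (m₂ * k))
    refine ⟨i, hi.trans ?_⟩
    exact congrArg₂ (fun a b => s(a, b)) (gridSiteH_eq u rfl rfl) (gridSiteH_eq v (Fin.ext hx) (by rw [← hy, ← hz]))
  | some x =>
    simp only [layerEdges, widthEdges, Finset.mem_filter, Finset.mem_univ, true_and] at he
    obtain ⟨u, v, rfl, hu, hv, hy, hz⟩ := he
    have huy := u.y.isLt
    have hvy := v.y.isLt
    have huz := u.z.isLt
    by_cases hx : Even (x : ℕ)
    · obtain ⟨i, hi⟩ := exists_edge_eq hm₁ hm₂ (some x) (h := u.y) (hy ▸ hvy : (u.y : ℕ) + 1 < m₂)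
        u.z
      refine ⟨i, hi.trans ?_⟩
      exact congrArg₂ (fun a b => s(a, b)) (gridSiteW_eq hu (by simp [hx]) (by simp [hx])) (gridSiteW_eq hv (by simp [hx, hy]) (by simp [hx, hz]))
    · obtain ⟨i, hi⟩ := exists_edge_eq hm₁ hm₂ (some x) (h := m₂ - 1 - v.y)
        (by simp only [layerWidth]; omega) (⟨k - 1 - u.z, by omega⟩ : Fin k)
      rw [Sym2.eq_swap]
      refine ⟨i, hi.trans ?_⟩
      exact congrArg₂ (fun a b => s(a, b)) (gridSiteW_eq hv (by simp [hx]) (by simp [hx, hz])) (gridSiteW_eq hu (by simp [hx]; omega) (by simp [hx]))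

/-! ### Disjointness of the layers -/

theorem of_mem_verticalEdges {u v : Site m₁ m₂ k} (h : s(u, v) ∈ verticalEdges m₁ m₂ k) :
    u.x = v.x ∧ u.y = v.y ∧ u ≠ v := by
  simp only [verticalEdges, Finset.mem_filter, Finset.mem_univ, true_and] at h
  obtain ⟨a, b, h, hx, hy, hz⟩ := h
  have hab : a ≠ b := by
    rintro rfl
    omega
  rcases Sym2.eq_iff.1 h with ⟨rfl, rfl⟩ | ⟨rfl, rfl⟩
  · exact ⟨hx, hy, hab⟩
  · exact ⟨hx.symm, hy.symm, hab.symm⟩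

theorem of_mem_horizontalEdges {u v : Site m₁ m₂ k} (h : s(u, v) ∈ horizontalEdges m₁ m₂ k) :
    u.x ≠ v.x ∧ u.z = v.z ∧ u.y = v.y := by
  simp only [horizontalEdges, Finset.mem_filter, Finset.mem_univ, true_and] at h
  obtain ⟨a, b, h, hx, hy, hz⟩ := h
  have hab : a.x ≠ b.x := by
    intro h
    rw [h] at hx
    omega
  rcases Sym2.eq_iff.1 h with ⟨rfl, rfl⟩ | ⟨rfl, rfl⟩
  · exact ⟨hab, hz, hy⟩
  · exact ⟨hab.symm, hz.symm, hy.symm⟩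

theorem of_mem_widthEdges {x : Fin m₁} {u v : Site m₁ m₂ k} (h : s(u, v) ∈ widthEdges m₁ m₂ k x) :
    u.x = x ∧ v.x = x ∧ u.y ≠ v.y ∧ u.z = v.z := by
  simp only [widthEdges, Finset.mem_filter, Finset.mem_univ, true_and] at h
  obtain ⟨a, b, h, hx, hx', hy, hz⟩ := h
  have hab : a.y ≠ b.y := by
    intro h
    rw [h] at hy
    omega
  rcases Sym2.eq_iff.1 h with ⟨rfl, rfl⟩ | ⟨rfl, rfl⟩
  · exact ⟨hx, hx', hab, hz⟩
  · exact ⟨hx', hx, hab.symm, hz.symm⟩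

theorem layerEdges_unique {l l' : Option (Fin m₁)} {e : Sym2 (Site m₁ m₂ k)}
    (h : e ∈ layerEdges m₁ m₂ k l) (h' : e ∈ layerEdges m₁ m₂ k l') : l = l' := by
  induction e with
  | _ u v =>
    cases l <;> cases l'
    · rfl
    · have h1 := of_mem_horizontalEdges h
      have h2 := of_mem_widthEdges h'
      exact absurd (h2.1.trans h2.2.1.symm) h1.1
    · have h1 := of_mem_horizontalEdges h'
      have h2 := of_mem_widthEdges h
      exact absurd (h2.1.trans h2.2.1.symm) h1.1
    · rw [← (of_mem_widthEdges h).1, ← (of_mem_widthEdges h').1]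

theorem layerEdges_not_vertical {l : Option (Fin m₁)} {e : Sym2 (Site m₁ m₂ k)}
    (h : e ∈ layerEdges m₁ m₂ k l) : e ∉ verticalEdges m₁ m₂ k := by
  intro h'
  induction e with
  | _ u v =>
    have h1 := of_mem_verticalEdges h'
    cases l
    · exact (of_mem_horizontalEdges h).1 h1.1
    · exact (of_mem_widthEdges h).2.2.1 h1.2.1

namespace EdgeIndex

theorem edge_not_mem_verticalEdges (i : EdgeIndex m₁ m₂ k) :
    i.edge ∉ verticalEdges m₁ m₂ k := layerEdges_not_vertical i.edge_mem

theorem hCoord_inf_edge (hm₂ : Odd m₂) (i : EdgeIndex m₁ m₂ k) :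
    hCoord i.layer i.edge.inf = i.col + 1 := by
  rw [i.inf_edge hm₂, fst, hCoord_gridSite]

theorem vCoord_inf_edge (hm₂ : Odd m₂) (i : EdgeIndex m₁ m₂ k) :
    vCoord i.layer i.edge.inf = i.row + 1 := by
  rw [i.inf_edge hm₂, fst, vCoord_gridSite hm₂]

theorem ext {i j : EdgeIndex m₁ m₂ k} (hl : i.layer = j.layer) (hc : i.col = j.col)
    (hr : (i.row : ℕ) = j.row) : i = j := by
  rcases i with ⟨l, a, v⟩ | ⟨l, a, v⟩ <;> rcases j with ⟨l', a', v'⟩ | ⟨l', a', v'⟩ <;>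
  simp only [layer, col, row, Sum.elim_inl, Sum.elim_inr] at hl hc hr <;> subst hl
  · rw [Fin.ext hr, Fin.ext (show (a : ℕ) = a' by omega)]
  · omega
  · omega
  · rw [Fin.ext hr, Fin.ext (show (a : ℕ) = a' by omega)]

theorem edge_injective (hm₂ : Odd m₂) :
    Function.Injective (edge : EdgeIndex m₁ m₂ k → Sym2 (Site m₁ m₂ k)) := fun i j h => by
  have hl : i.layer = j.layer := layerEdges_unique i.edge_mem (h ▸ j.edge_mem)
  have h1 := i.hCoord_inf_edge hm₂
  have h2 := i.vCoord_inf_edge hm₂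
  rw [h, hl, j.hCoord_inf_edge hm₂] at h1
  rw [h, show vCoord i.layer j.edge.inf = vCoord j.layer j.edge.inf by rw [hl],
    j.vCoord_inf_edge hm₂] at h2
  exact ext hl (by omega) (by omega)

end EdgeIndex

/-- The vertical edges and the edges of the layers are all edges. -/
theorem mem_edgeSet_iff (hm₁ : Odd m₁) (hm₂ : Odd m₂) {e : Sym2 (Site m₁ m₂ k)} :
    e ∈ (graph m₁ m₂ k).edgeSet ↔
      e ∈ verticalEdges m₁ m₂ k ∨ ∃ i : EdgeIndex m₁ m₂ k, i.edge = e := by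
  rw [graph, SimpleGraph.edgeSet_fromEdgeSet, Set.mem_sdiff, Set.mem_ofPred_eq]
  constructor
  · rintro ⟨h | ⟨x, h⟩ | h, -⟩
    · exact Or.inl h
    · exact Or.inr (mem_range_edge hm₁ hm₂ (l := some x) h)
    · exact Or.inr (mem_range_edge hm₁ hm₂ (l := none) h)
  · rintro (h | ⟨i, rfl⟩)
    · refine ⟨Or.inl h, ?_⟩
      induction e with
      | _ u v => exact fun hd => (of_mem_verticalEdges h).2.2 hd
    · constructor
      · have := i.edge_mem
        generalize i.layer = l at this
        cases l with
        | none => exact Or.inr (Or.inr this)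
        | some x => exact Or.inr (Or.inl ⟨x, this⟩)
      · exact fun hd => (i.fst_lt_snd hm₂).ne hd

/-! ### Crossings of edges of the lattice -/

theorem pos_sup_of_mem_verticalEdges {e : Sym2 (Site m₁ m₂ k)} (h : e ∈ verticalEdges m₁ m₂ k) :
    e.sup.pos = e.inf.pos + 1 := by
  simp only [verticalEdges, Finset.mem_filter, Finset.mem_univ, true_and] at h
  obtain ⟨u, v, rfl, hx, hy, hz⟩ := h
  have hvz := v.z.isLt
  have hc : u.column = v.column := by rw [Site.column, Site.column, hx, hy]
  have h1 : v.pos = u.pos + 1 ∨ u.pos = v.pos + 1 := by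
    rw [Site.pos, Site.pos, hc, Site.height, Site.height, hc]
    split_ifs <;> omega
  rcases h1 with h | h
  · have hlt : u < v := Site.lt_iff_pos_lt.2 (by omega)
    rw [Sym2.sup_mk, Sym2.inf_mk, sup_of_le_right hlt.le, inf_of_le_left hlt.le, h]
  · have hlt : v < u := Site.lt_iff_pos_lt.2 (by omega)
    rw [Sym2.sup_mk, Sym2.inf_mk, sup_of_le_left hlt.le, inf_of_le_right hlt.le, h]

theorem not_crosses_of_mem_verticalEdges_left {e f : Sym2 (Site m₁ m₂ k)}
    (h : e ∈ verticalEdges m₁ m₂ k) : ¬ Crosses e f := fun hc => by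
  have h1 := Site.lt_iff_pos_lt.1 hc.1
  have h2 := Site.lt_iff_pos_lt.1 hc.2.1
  have h3 := pos_sup_of_mem_verticalEdges h
  omega

theorem not_crosses_of_mem_verticalEdges_right {e f : Sym2 (Site m₁ m₂ k)}
    (h : f ∈ verticalEdges m₁ m₂ k) : ¬ Crosses e f := fun hc => by
  have h1 := Site.lt_iff_pos_lt.1 hc.2.1
  have h2 := Site.lt_iff_pos_lt.1 hc.2.2
  have h3 := pos_sup_of_mem_verticalEdges h
  omega

theorem mul_le_snake (n h v : ℕ) : h * n ≤ snake n h v := Nat.le_add_right _ _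

theorem snake_lt_mul {n v : ℕ} (h : ℕ) (hv : v < n) : snake n h v < (h + 1) * n := by
  rw [snake, Nat.add_mul, one_mul]
  split_ifs <;> omega

theorem snake_crosses_iff {n v v' : ℕ} (h h' : ℕ) (hv : v < n) (hv' : v' < n) :
    (snake n h v < snake n h' v' ∧ snake n h' v' < snake n (h + 1) v ∧
      snake n (h + 1) v < snake n (h' + 1) v') ↔
      h' = h + 1 ∧ if Even h' then v' < v else v < v' := by
  rcases lt_trichotomy h' h with hlt | rfl | hgt
  · have h1 : (h' + 1) * n ≤ h * n := Nat.mul_le_mul_right _ hlt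
    have h2 := mul_le_snake n h v
    have h3 := snake_lt_mul h' hv'
    constructor <;> omega
  · constructor
    · rintro ⟨h1, -, h3⟩
      unfold snake at h1 h3
      by_cases he : Even h' <;> simp only [he, Nat.even_add_one, if_true, if_false, not_true,
        not_false_iff] at h1 h3 <;> omega
    · omega
  · rcases eq_or_lt_of_le (show h + 1 ≤ h' from hgt) with rfl | hgt
    · have h1 := snake_lt_mul h hv
      have h2 := mul_le_snake n (h + 1) v'
      have h3 := snake_lt_mul (h + 1) hv
      have h4 := mul_le_snake n ((h + 1) + 1) v'
      have h5 : snake n (h + 1) v' < snake n (h + 1) v ↔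
          if Even (h + 1) then v' < v else v < v' := by
        unfold snake
        split_ifs <;> omega
      rw [← h5]
      constructor
      · rintro ⟨-, h6, -⟩
        exact ⟨rfl, h6⟩
      · rintro ⟨-, h6⟩
        exact ⟨by omega, h6, by omega⟩
    · have h1 : (h + 1 + 1) * n ≤ h' * n := Nat.mul_le_mul_right _ hgt
      have h2 := snake_lt_mul (h + 1) hv
      have h3 := mul_le_snake n h' v'
      constructor <;> omega

namespace EdgeIndex

theorem pos_fst (hm₂ : Odd m₂) (i : EdgeIndex m₁ m₂ k) : i.fst.pos =
    layerBase m₁ m₂ k i.layer + snake (layerRows m₁ m₂ k i.layer) i.col i.row := by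
  rw [fst, pos_gridSite hm₂]

theorem pos_snd (hm₂ : Odd m₂) (i : EdgeIndex m₁ m₂ k) : i.snd.pos =
    layerBase m₁ m₂ k i.layer + snake (layerRows m₁ m₂ k i.layer) (i.col + 1) i.row := by
  rw [snd, pos_gridSite hm₂]

theorem crosses_iff (hm₂ : Odd m₂) (i j : EdgeIndex m₁ m₂ k) : Crosses i.edge j.edge ↔
    i.fst.pos < j.fst.pos ∧ j.fst.pos < i.snd.pos ∧ i.snd.pos < j.snd.pos := by
  rw [Crosses, i.inf_edge hm₂, i.sup_edge hm₂, j.inf_edge hm₂, j.sup_edge hm₂]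
  rfl

theorem crosses_iff_of_layer_eq (hm₂ : Odd m₂) {i j : EdgeIndex m₁ m₂ k}
    (h : i.layer = j.layer) : Crosses i.edge j.edge ↔
      j.col = i.col + 1 ∧ if Even j.col then (j.row : ℕ) < i.row else (i.row : ℕ) < j.row := by
  have hi := i.row.isLt
  have hj := j.row.isLt
  rw [i.crosses_iff hm₂, i.pos_fst hm₂, i.pos_snd hm₂, j.pos_fst hm₂, j.pos_snd hm₂]
  generalize (i.row : ℕ) = v at *
  generalize (j.row : ℕ) = v' at *
  rw [← h] at hj ⊢
  rw [Nat.add_lt_add_iff_left, Nat.add_lt_add_iff_left, Nat.add_lt_add_iff_left,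
    snake_crosses_iff _ _ hi hj]

theorem pos_mem_block (hm₂ : Odd m₂) {x : Fin m₁} {i : EdgeIndex m₁ m₂ k}
    (h : i.layer = some x) : x * (m₂ * k) ≤ i.fst.pos ∧ i.snd.pos < (x + 1) * (m₂ * k) := by
  have hi := i.row.isLt
  have hc := i.col_add_one_lt
  rw [i.pos_fst hm₂, i.pos_snd hm₂]
  generalize (i.row : ℕ) = v at *
  rw [h] at hi hc ⊢
  simp only [layerBase, layerRows, layerWidth] at hi hc ⊢
  have h1 := snake_lt_mul (i.col + 1) hi
  have h2 : (i.col + 1 + 1) * k ≤ m₂ * k := Nat.mul_le_mul_right _ hc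
  rw [Nat.add_mul x.val, one_mul]
  omega

theorem not_crosses_of_layer_ne (hm₂ : Odd m₂) {i j : EdgeIndex m₁ m₂ k} (hi : i.layer ≠ none)
    (hj : j.layer ≠ none) (h : i.layer ≠ j.layer) : ¬ Crosses i.edge j.edge := by
  obtain ⟨x, hx⟩ := Option.ne_none_iff_exists'.1 hi
  obtain ⟨y, hy⟩ := Option.ne_none_iff_exists'.1 hj
  have h1 := pos_mem_block hm₂ hx
  have h2 := pos_mem_block hm₂ hy
  have hxy : (x : ℕ) ≠ y := by
    rw [hx, hy] at h
    exact fun hv => h (congrArg some (Fin.ext hv))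
  rw [crosses_iff hm₂]
  rintro ⟨h3, h4, -⟩
  have h5 := Site.lt_iff_pos_lt.1 (i.fst_lt_snd hm₂)
  have h6 := Site.lt_iff_pos_lt.1 (j.fst_lt_snd hm₂)
  rcases lt_or_gt_of_ne hxy with hlt | hlt
  · have : (x + 1) * (m₂ * k) ≤ y * (m₂ * k) := Nat.mul_le_mul_right _ hlt
    omega
  · have : (y + 1) * (m₂ * k) ≤ x * (m₂ * k) := Nat.mul_le_mul_right _ hlt
    omega

/-- Consecutive edges in a row of a layer share a vertex. -/
theorem snd_eq_fst {i j : EdgeIndex m₁ m₂ k} (hl : i.layer = j.layer) (hc : j.col = i.col + 1)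
    (hr : (i.row : ℕ) = j.row) : i.snd = j.fst := by
  rcases i with ⟨l, a, v⟩ | ⟨l, a, v⟩ <;> rcases j with ⟨l', a', v'⟩ | ⟨l', a', v'⟩ <;>
  simp only [layer, col, row, Sum.elim_inl, Sum.elim_inr] at hl hc hr <;> subst hl <;>
  obtain rfl := Fin.ext hr <;> simp [fst, snd, layer, col, row, hc]

end EdgeIndex

open scoped Classical in
@[to_additive]
theorem prod_eq_prod_edgeIndex (hm₁ : Odd m₁) (hm₂ : Odd m₂) {M : Type*} [CommMonoid M]
    {P : Finset (Sym2 (Site m₁ m₂ k))} (hP : ∀ e ∈ P, e ∈ (graph m₁ m₂ k).edgeSet)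
    {g : Sym2 (Site m₁ m₂ k) → M} (hg : ∀ e ∈ verticalEdges m₁ m₂ k, g e = 1) :
    ∏ e ∈ P, g e = ∏ i : EdgeIndex m₁ m₂ k with i.edge ∈ P, g i.edge := by
  rw [← Finset.prod_image fun i _ j _ h => EdgeIndex.edge_injective hm₂ h]
  refine (Finset.prod_subset ?_ fun e he hne => ?_).symm
  · intro e he
    obtain ⟨i, hi, rfl⟩ := Finset.mem_image.1 he
    exact (Finset.mem_filter.1 hi).2
  · rcases (mem_edgeSet_iff hm₁ hm₂).1 (hP e he) with h | ⟨i, rfl⟩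
    · exact hg e h
    · exact absurd (Finset.mem_image.2 ⟨i, Finset.mem_filter.2 ⟨Finset.mem_univ _, he⟩, rfl⟩) hne

/-- The edges of a set with even column number, as a vector modulo `2`. -/
noncomputable def leftVector (P : Finset (Sym2 (Site m₁ m₂ k))) : HalfIndex m₁ m₂ k → ZMod 2 :=
  fun i => parityInd (EdgeIndex.edge (Sum.inl i) ∈ P)

/-- The edges of a set with odd column number, as a vector modulo `2`. -/
noncomputable def rightVector (P : Finset (Sym2 (Site m₁ m₂ k))) : HalfIndex m₁ m₂ k → ZMod 2 :=
  fun i => parityInd (EdgeIndex.edge (Sum.inr i) ∈ P)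

section CrossingParity

open Classical EdgeIndex

variable {P : Finset (Sym2 (Site m₁ m₂ k))}

theorem crossingParity_eq_sum_edgeIndex (hm₁ : Odd m₁) (hm₂ : Odd m₂)
    (hP : ∀ e ∈ P, e ∈ (graph m₁ m₂ k).edgeSet) :
    crossingParity P = ∑ i : EdgeIndex m₁ m₂ k with i.edge ∈ P,
      ∑ j : EdgeIndex m₁ m₂ k with j.edge ∈ P, parityInd (Crosses i.edge j.edge) := by
  rw [crossingParity, sum_eq_sum_edgeIndex hm₁ hm₂ hP]
  · refine Finset.sum_congr rfl fun i _ => ?_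
    rw [sum_eq_sum_edgeIndex hm₁ hm₂ hP]
    exact fun e he => parityInd_false (not_crosses_of_mem_verticalEdges_right he)
  · exact fun e he => Finset.sum_eq_zero fun f _ =>
      parityInd_false (not_crosses_of_mem_verticalEdges_left he)

/-- Crossings between different layers can be ignored. -/
theorem crossingParity_eq_sum_layers (hm₁ : Odd m₁) (hm₂ : Odd m₂)
    (hP : ∀ e ∈ P, e ∈ (graph m₁ m₂ k).edgeSet)
    (hev : ∀ e ∈ P, ∑ f ∈ P, (parityInd (Crosses e f) + parityInd (Crosses f e)) = 0) :
    crossingParity P = ∑ i : EdgeIndex m₁ m₂ k with i.edge ∈ P,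
      ∑ j : EdgeIndex m₁ m₂ k with j.edge ∈ P,
        if i.layer = j.layer then parityInd (Crosses i.edge j.edge) else 0 := by
  rw [crossingParity_eq_sum_edgeIndex hm₁ hm₂ hP]
  set T : Finset (EdgeIndex m₁ m₂ k) := {i | i.edge ∈ P} with hT
  have h1 := sum_filter_interaction_eq_zero T (fun i => i.layer = none)
    (fun i j => parityInd (Crosses i.edge j.edge)) fun i hi => by
      rw [← hev i.edge (Finset.mem_filter.1 hi).2, sum_eq_sum_edgeIndex hm₁ hm₂ hP]
      intro e he
      rw [parityInd_false (not_crosses_of_mem_verticalEdges_right he),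
        parityInd_false (not_crosses_of_mem_verticalEdges_left he), add_zero]
  have h2 : ∑ i ∈ T with i.layer = none, ∑ j ∈ T with ¬ j.layer = none,
      (parityInd (Crosses i.edge j.edge) + parityInd (Crosses j.edge i.edge)) =
      ∑ i ∈ T, ∑ j ∈ T, ((if i.layer = none ∧ ¬ j.layer = none then
          parityInd (Crosses i.edge j.edge) else 0) +
        if j.layer = none ∧ ¬ i.layer = none then parityInd (Crosses i.edge j.edge) else 0) := by
    have h3 : ∑ i ∈ T, ∑ j ∈ T, (if j.layer = none ∧ ¬ i.layer = none then
          parityInd (Crosses i.edge j.edge) else 0) =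
        ∑ i ∈ T, ∑ j ∈ T, if i.layer = none ∧ ¬ j.layer = none then
          parityInd (Crosses j.edge i.edge) else 0 := Finset.sum_comm
    simp_rw [Finset.sum_add_distrib]
    rw [h3]
    simp_rw [← Finset.sum_add_distrib]
    rw [Finset.sum_filter]
    refine Finset.sum_congr rfl fun i _ => ?_
    by_cases hi : i.layer = none
    · rw [if_pos hi, Finset.sum_filter]
      refine Finset.sum_congr rfl fun j _ => ?_
      by_cases hj : j.layer = none <;> simp [hi, hj]
    · simp [hi]
  apply zmod_two_eq_of_add_eq_zero
  refine Eq.trans ?_ (h2.symm.trans h1)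
  simp_rw [← Finset.sum_add_distrib]
  refine Finset.sum_congr rfl fun i _ => Finset.sum_congr rfl fun j _ => ?_
  by_cases hij : i.layer = j.layer
  · rw [if_pos hij, zmod_two_add_self, hij]
    simp
  · rw [if_neg hij]
    by_cases hi : i.layer = none
    · have hj : ¬ j.layer = none := fun h => hij (hi.trans h.symm)
      simp [hi, hj]
    · by_cases hj : j.layer = none
      · simp [hi, hj]
      · simp [hi, hj, parityInd_false (not_crosses_of_layer_ne hm₂ hi hj hij)]

theorem row_ne_row (hP : IsDimer (graph m₁ m₂ k) P) (hm₂ : Odd m₂) {i j : EdgeIndex m₁ m₂ k}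
    (hi : i.edge ∈ P) (hj : j.edge ∈ P) (hl : i.layer = j.layer) (hc : j.col = i.col + 1) :
    (i.row : ℕ) ≠ j.row := fun hr => by
  have h := snd_eq_fst hl hc hr
  have h1 : i.edge = j.edge := (hP.2 i.snd).unique ⟨hi, Sym2.mem_mk_right _ _⟩
    ⟨hj, by rw [h]; exact Sym2.mem_mk_left _ _⟩
  have h2 := edge_injective hm₂ h1
  rw [h2] at hc
  omega

open scoped Matrix in
/-- The crossing parity of a perfect matching is a bilinear form. -/
theorem crossingParity_eq_dotProduct (hm₁ : Odd m₁) (hm₂ : Odd m₂)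
    (hP : IsDimer (graph m₁ m₂ k) P)
    (hev : ∀ e ∈ P, ∑ f ∈ P, (parityInd (Crosses e f) + parityInd (Crosses f e)) = 0) :
    crossingParity P = rightVector P ⬝ᵥ
      formMatrixInv (layerCols m₁ m₂) (layerRows m₁ m₂ k) *ᵥ leftVector P := by
  let x : EdgeIndex m₁ m₂ k → EdgeIndex m₁ m₂ k → ZMod 2 := fun i j =>
    parityInd (i.edge ∈ P) * (parityInd (j.edge ∈ P) *
      if i.layer = j.layer then parityInd (Crosses i.edge j.edge) else 0)
  have h1 : crossingParity P = ∑ i, ∑ j, x i j := by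
    rw [crossingParity_eq_sum_layers hm₁ hm₂ hP.1 hev, Finset.sum_filter]
    refine Finset.sum_congr rfl fun i _ => ?_
    rw [← Finset.mul_sum, Finset.sum_filter]
    by_cases hi : i.edge ∈ P
    · rw [if_pos hi, parityInd_true hi, one_mul]
      refine Finset.sum_congr rfl fun j _ => ?_
      by_cases hj : j.edge ∈ P
      · rw [if_pos hj, parityInd_true hj, one_mul]
      · rw [if_neg hj, parityInd_false hj, zero_mul]
    · rw [if_neg hi, parityInd_false hi, zero_mul]
  have hll : ∀ i j : HalfIndex m₁ m₂ k, x (Sum.inl i) (Sum.inl j) = 0 := fun i j => by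
    simp only [x]
    split_ifs with hl
    · rw [parityInd_false (p := Crosses _ _), mul_zero, mul_zero]
      rw [crosses_iff_of_layer_eq hm₂ hl]
      rintro ⟨h, -⟩
      simp only [col, Sum.elim_inl] at h
      omega
    · rw [mul_zero, mul_zero]
  have hrr : ∀ i j : HalfIndex m₁ m₂ k, x (Sum.inr i) (Sum.inr j) = 0 := fun i j => by
    simp only [x]
    split_ifs with hl
    · rw [parityInd_false (p := Crosses _ _), mul_zero, mul_zero]
      rw [crosses_iff_of_layer_eq hm₂ hl]
      rintro ⟨h, -⟩
      simp only [col, Sum.elim_inr] at h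
      omega
    · rw [mul_zero, mul_zero]
  have hrl : ∀ i j : HalfIndex m₁ m₂ k, x (Sum.inl j) (Sum.inr i) + x (Sum.inr i) (Sum.inl j) =
      rightVector P i *
        (formMatrixInv (layerCols m₁ m₂) (layerRows m₁ m₂ k) i j * leftVector P j) :=
    fun i j => by
    simp only [x, rightVector, leftVector]
    by_cases hi : edge (Sum.inr i) ∈ P
    swap
    · rw [parityInd_false hi]
      ring
    by_cases hj : edge (Sum.inl j) ∈ P
    swap
    · rw [parityInd_false hj]
      ring
    rw [parityInd_true hi, parityInd_true hj, one_mul, one_mul, one_mul, mul_one, one_mul, one_mul,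
      formMatrixInv_apply]
    by_cases hl : layer (Sum.inr i) = layer (Sum.inl j)
    swap
    · rw [if_neg (Ne.symm hl), if_neg hl, parityInd_false fun h => hl h.1, add_zero]
    rw [if_pos hl, if_pos hl.symm, crosses_iff_of_layer_eq hm₂ hl,
      crosses_iff_of_layer_eq hm₂ hl.symm]
    have hc1 : col (Sum.inr i) = 2 * (i.2.1 : ℕ) := rfl
    have hc2 : col (Sum.inl j) = 2 * (j.2.1 : ℕ) + 1 := rfl
    have h3 := row_ne_row hP hm₂ hi hj hl
    have h4 := row_ne_row hP hm₂ hj hi hl.symm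
    have hr1 : (row (Sum.inr i) : ℕ) = i.2.2 := rfl
    have hr2 : (row (Sum.inl j) : ℕ) = j.2.2 := rfl
    rw [hc1, hc2, hr1, hr2] at h3
    rw [hc1, hc2, hr1, hr2] at h4
    rw [hc1, hc2, hr1, hr2, if_pos (even_two_mul _), if_neg (by simp)]
    have e1 : ∀ p q r : Prop, (p ∨ q ↔ r) → ¬ (p ∧ q) →
        parityInd p + parityInd q = parityInd r := fun p q r h hpq => by
      rw [← propext h]
      by_cases hp : p <;> by_cases hq : q <;> simp [parityInd, hp, hq] at hpq ⊢
    apply e1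
    · constructor
      · rintro (⟨h, h'⟩ | ⟨h, h'⟩) <;> exact ⟨hl, by omega, by omega⟩
      · rintro ⟨-, h | h, h'⟩ <;> omega
    · omega
  rw [h1, Fintype.sum_sum_type]
  simp_rw [Fintype.sum_sum_type, hll, hrr, Finset.sum_const_zero, zero_add, add_zero]
  rw [Finset.sum_comm, ← Finset.sum_add_distrib]
  simp only [dotProduct, Matrix.mulVec, Finset.mul_sum]
  refine Finset.sum_congr rfl fun i _ => ?_
  rw [← Finset.sum_add_distrib]
  exact Finset.sum_congr rfl fun j _ => hrl i j

end CrossingParity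

/-! ### Orientations -/

theorem card_halfIndex (hm₁ : Odd m₁) (hm₂ : Odd m₂) :
    Fintype.card (HalfIndex m₁ m₂ k) = halfCount m₁ m₂ k := by
  obtain ⟨a, rfl⟩ := hm₁
  obtain ⟨b, rfl⟩ := hm₂
  rw [Fintype.card_sigma, Fintype.sum_option]
  simp only [Fintype.card_prod, Fintype.card_fin]
  simp only [layerCols, layerWidth, layerRows, Finset.sum_const, Finset.card_univ,
    Fintype.card_fin, smul_eq_mul, halfCount, Nat.add_sub_cancel]
  rw [Nat.mul_div_cancel_left _ two_pos, Nat.mul_div_cancel_left _ two_pos,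
    show k * (2 * a + 1) * (2 * b) = 2 * (k * (2 * a + 1) * b) by ring,
    show k * (2 * b + 1) * (2 * a) = 2 * (k * (2 * b + 1) * a) by ring,
    Nat.mul_div_cancel_left _ two_pos, Nat.mul_div_cancel_left _ two_pos]
  ring

theorem mem_pairs_iff (hm₁ : Odd m₁) (hm₂ : Odd m₂)
    {p : Sym2 (Site m₁ m₂ k) × Sym2 (Site m₁ m₂ k)} :
    p ∈ pairs m₁ m₂ k ↔ ∃ i j : HalfIndex m₁ m₂ k,
      formMatrix (layerCols m₁ m₂) (layerRows m₁ m₂ k) i j = 1 ∧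
        (EdgeIndex.edge (Sum.inl i), EdgeIndex.edge (Sum.inr j)) = p := by
  have h1 : p ∈ pairs m₁ m₂ k ↔
      ∃ l, p ∈ layerPairs (layerEdges m₁ m₂ k l) (hCoord l) (vCoord l) := by
    rw [Option.exists]
    simp only [pairs, Finset.mem_union, Finset.mem_biUnion, Finset.mem_univ, true_and]
    rfl
  have h2 : ∀ q : Prop, parityInd q = 1 ↔ q := fun q => by
    by_cases h : q <;> simp [parityInd, h]
  rw [h1]
  simp only [formMatrix_apply, h2]
  simp only [layerPairs, Finset.mem_filter, Finset.mem_product]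
  constructor
  · rintro ⟨l, ⟨hp1, hp2⟩, hh, hv, hv', he, ho⟩
    obtain ⟨i, hi⟩ := mem_range_edge hm₁ hm₂ hp1
    obtain ⟨j, hj⟩ := mem_range_edge hm₁ hm₂ hp2
    rw [← hi] at hp1
    rw [← hj] at hp2
    obtain rfl := layerEdges_unique i.edge_mem hp1
    have hl := layerEdges_unique j.edge_mem hp2
    have e1 := i.hCoord_inf_edge hm₂
    have e2 := i.vCoord_inf_edge hm₂
    have e3 := j.hCoord_inf_edge hm₂
    have e4 := j.vCoord_inf_edge hm₂
    rw [show hCoord j.layer j.edge.inf = hCoord i.layer j.edge.inf by rw [hl]] at e3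
    rw [show vCoord j.layer j.edge.inf = vCoord i.layer j.edge.inf by rw [hl]] at e4
    rw [← hi] at hh hv hv' he
    rw [← hj] at hh hv hv' ho
    rw [e1, e3] at hh
    rw [e2, e4] at hv hv'
    rw [e1] at he
    rw [e3] at ho
    rcases i with i | i
    swap
    · simp [EdgeIndex.col] at he
    rcases j with j | j
    · simp [EdgeIndex.col, parity_simps] at ho
    refine ⟨i, j, ⟨hl.symm, ?_, ?_⟩, Prod.ext hi hj⟩
    · simp only [EdgeIndex.col, Sum.elim_inl, Sum.elim_inr] at hh
      omega
    · simp only [EdgeIndex.row] at hv hv'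
      omega
  · rintro ⟨i, j, ⟨hl, hc, hr⟩, rfl⟩
    have e1 := EdgeIndex.hCoord_inf_edge hm₂ (Sum.inl i)
    have e2 := EdgeIndex.vCoord_inf_edge hm₂ (Sum.inl i)
    have e3 := EdgeIndex.hCoord_inf_edge hm₂ (Sum.inr j)
    have e4 := EdgeIndex.vCoord_inf_edge hm₂ (Sum.inr j)
    have hl' : EdgeIndex.layer (Sum.inr j) = EdgeIndex.layer (Sum.inl i) := hl.symm
    have hm := EdgeIndex.edge_mem (Sum.inr j)
    rw [hl'] at hm
    rw [show hCoord (EdgeIndex.layer (Sum.inr j)) = hCoord (m₂ := m₂) (k := k)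
      (EdgeIndex.layer (Sum.inl i)) by rw [hl']] at e3
    rw [show vCoord (EdgeIndex.layer (Sum.inr j)) = vCoord (m₂ := m₂) (k := k)
      (EdgeIndex.layer (Sum.inl i)) by rw [hl']] at e4
    refine ⟨EdgeIndex.layer (Sum.inl i), ⟨EdgeIndex.edge_mem (Sum.inl i), hm⟩, ?_⟩
    rw [e1, e2, e3, e4]
    simp only [EdgeIndex.col, EdgeIndex.row, Sum.elim_inl, Sum.elim_inr]
    refine ⟨by omega, by omega, by omega, ?_, ?_⟩
    · exact ⟨i.2.1 + 1, by ring⟩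
    · exact ⟨j.2.1, rfl⟩

/-- The negative edges with even column number, and those with odd column number, of an
orientation, as vectors modulo `2`. -/
noncomputable def signVectors (D : Digraph (Site m₁ m₂ k)) :
    (HalfIndex m₁ m₂ k → ZMod 2) × (HalfIndex m₁ m₂ k → ZMod 2) :=
  (fun i => parityInd (edgeSign D (EdgeIndex.edge (Sum.inl i)) = -1),
    fun i => parityInd (edgeSign D (EdgeIndex.edge (Sum.inr i)) = -1))

open scoped Classical in
theorem even_card_pairs_iff (hm₁ : Odd m₁) (hm₂ : Odd m₂) (D : Digraph (Site m₁ m₂ k)) :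
    Even {p ∈ pairs m₁ m₂ k | edgeSign D p.1 = -1 ∧ edgeSign D p.2 = -1}.card ↔
      (signVectors D).1 ⬝ᵥ (formMatrix (layerCols m₁ m₂) (layerRows m₁ m₂ k)).mulVec
        (signVectors D).2 = 0 := by
  set A := formMatrix (layerCols m₁ m₂) (layerRows m₁ m₂ k) with hA
  let f : HalfIndex m₁ m₂ k × HalfIndex m₁ m₂ k → Sym2 (Site m₁ m₂ k) × Sym2 (Site m₁ m₂ k) :=
    fun t => (EdgeIndex.edge (Sum.inl t.1), EdgeIndex.edge (Sum.inr t.2))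
  have hf : Function.Injective f := fun s t h => by
    have h1 := Sum.inl_injective (EdgeIndex.edge_injective hm₂ (Prod.ext_iff.1 h).1)
    have h2 := Sum.inr_injective (EdgeIndex.edge_injective hm₂ (Prod.ext_iff.1 h).2)
    exact Prod.ext h1 h2
  have h1 : ({p ∈ pairs m₁ m₂ k | edgeSign D p.1 = -1 ∧ edgeSign D p.2 = -1} : Finset _) =
      ({t | A t.1 t.2 = 1 ∧ edgeSign D (f t).1 = -1 ∧ edgeSign D (f t).2 = -1} :
        Finset (HalfIndex m₁ m₂ k × HalfIndex m₁ m₂ k)).image f := by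
    ext p
    simp only [Finset.mem_filter, Finset.mem_image, Finset.mem_univ, true_and,
      mem_pairs_iff hm₁ hm₂]
    constructor
    · rintro ⟨⟨i, j, h, rfl⟩, h'⟩
      exact ⟨(i, j), ⟨h, h'⟩, rfl⟩
    · rintro ⟨⟨i, j⟩, ⟨h, h'⟩, rfl⟩
      exact ⟨⟨i, j, h, rfl⟩, h'⟩
  rw [h1, Finset.card_image_of_injective _ hf, ← ZMod.natCast_eq_zero_iff_even,
    Finset.natCast_card_filter, Fintype.sum_prod_type]
  simp only [dotProduct, Matrix.mulVec, Finset.mul_sum]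
  refine Eq.congr (Finset.sum_congr rfl fun i _ => Finset.sum_congr rfl fun j _ => ?_) rfl
  have h2 : ∀ a : ZMod 2, a = 1 ∨ a = 0 := by decide
  simp only [signVectors, f]
  rcases h2 (A i j) with h | h <;> rw [h] <;>
  by_cases h3 : edgeSign D (EdgeIndex.edge (Sum.inl i)) = -1 <;>
  by_cases h4 : edgeSign D (EdgeIndex.edge (Sum.inr j)) = -1 <;> simp [h3, h4, parityInd]

theorem edgeSign_eq_one_or (D : Digraph (Site m₁ m₂ k)) (e : Sym2 (Site m₁ m₂ k)) :
    edgeSign D e = 1 ∨ edgeSign D e = -1 := by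
  unfold edgeSign
  split_ifs <;> simp

theorem edgeSign_eq_one_iff (D : Digraph (Site m₁ m₂ k)) (e : Sym2 (Site m₁ m₂ k)) :
    edgeSign D e = 1 ↔ D.Adj e.inf e.sup := by
  unfold edgeSign
  split_ifs with h <;> simp [h]

theorem edgeSign_eq_parityChar (D : Digraph (Site m₁ m₂ k)) (e : Sym2 (Site m₁ m₂ k)) :
    edgeSign D e = parityChar (parityInd (edgeSign D e = -1)) := by
  rcases edgeSign_eq_one_or D e with h | h
  · rw [parityChar_parityInd_of_false (by rw [h]; decide), h]
  · rw [parityChar_parityInd_of_true h, h]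

theorem _root_.IsOrientation.adj_iff {D : Digraph (Site m₁ m₂ k)}
    (hD : IsOrientation (graph m₁ m₂ k) D) (u v : Site m₁ m₂ k) :
    D.Adj u v ↔ (graph m₁ m₂ k).Adj u v ∧ (u < v ↔ edgeSign D s(u, v) = 1) := by
  rw [edgeSign_eq_one_iff]
  by_cases h : (graph m₁ m₂ k).Adj u v
  · rcases lt_or_gt_of_ne h.ne with hlt | hlt
    · rw [Sym2.inf_mk, Sym2.sup_mk, inf_of_le_left hlt.le, sup_of_le_right hlt.le]
      simp [h, hlt]
    · rw [Sym2.inf_mk, Sym2.sup_mk, inf_of_le_right hlt.le, sup_of_le_left hlt.le]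
      simp [h, hlt.not_gt, hD.2 u v h]
  · simp only [h, false_and, iff_false]
    exact fun h' => h (hD.1 u v h')

/-- The orientation whose negative edges are those in `N`. -/
def orientationOf (N : Set (Sym2 (Site m₁ m₂ k))) : Digraph (Site m₁ m₂ k) where
  Adj u v := (graph m₁ m₂ k).Adj u v ∧ (u < v ↔ s(u, v) ∉ N)

theorem isOrientation_orientationOf (N : Set (Sym2 (Site m₁ m₂ k))) :
    IsOrientation (graph m₁ m₂ k) (orientationOf N) := by
  refine ⟨fun u v h => h.1, fun u v h => ?_⟩
  have h1 : v < u ↔ ¬ u < v := by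
    rw [not_lt, le_iff_lt_or_eq, or_iff_left h.ne.symm]
  simp only [orientationOf, h, h.symm, true_and, Sym2.eq_swap (a := v), h1]
  tauto

theorem edgeSign_orientationOf_eq_one_iff (N : Set (Sym2 (Site m₁ m₂ k)))
    {e : Sym2 (Site m₁ m₂ k)} (he : e ∈ (graph m₁ m₂ k).edgeSet) :
    edgeSign (orientationOf N) e = 1 ↔ e ∉ N := by
  induction e with
  | _ u v =>
    have h : (graph m₁ m₂ k).Adj u v := he
    have h1 := (isOrientation_orientationOf N).adj_iff u v
    have h2 : (orientationOf N).Adj u v ↔ (graph m₁ m₂ k).Adj u v ∧ (u < v ↔ s(u, v) ∉ N) :=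
      Iff.rfl
    rw [h2] at h1
    simp only [h, true_and] at h1
    tauto

open scoped Classical in
/-- Summation over all orientations with positive vertical edges. -/
theorem sum_orientations (hm₁ : Odd m₁) (hm₂ : Odd m₂) {M : Type*} [AddCommMonoid M]
    (F : (HalfIndex m₁ m₂ k → ZMod 2) × (HalfIndex m₁ m₂ k → ZMod 2) → M) :
    ∑ D : Digraph (Site m₁ m₂ k) with IsOrientation (graph m₁ m₂ k) D ∧
      ∀ e ∈ verticalEdges m₁ m₂ k, edgeSign D e = 1, F (signVectors D) = ∑ x, F x := by
  refine Finset.sum_nbij signVectors (fun _ _ => Finset.mem_univ _) ?_ ?_ fun _ _ => rfl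
  · intro D hD D' hD' h
    simp only [Finset.coe_filter, Finset.mem_univ, true_and, Set.mem_ofPred_eq] at hD hD'
    have h0 : ∀ p q : Prop, parityInd p = parityInd q → (p ↔ q) := fun p q h => by
      by_cases hp : p <;> by_cases hq : q <;> simp [parityInd, hp, hq] at h ⊢
    have h1 : ∀ i : EdgeIndex m₁ m₂ k, edgeSign D i.edge = -1 ↔ edgeSign D' i.edge = -1 := by
      rintro (i | i)
      · exact h0 _ _ (congrFun (Prod.ext_iff.1 h).1 i)
      · exact h0 _ _ (congrFun (Prod.ext_iff.1 h).2 i)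
    have h2 : ∀ e ∈ (graph m₁ m₂ k).edgeSet, (edgeSign D e = 1 ↔ edgeSign D' e = 1) := by
      intro e he
      rcases (mem_edgeSet_iff hm₁ hm₂).1 he with hv | ⟨i, rfl⟩
      · simp [hD.2 e hv, hD'.2 e hv]
      · have := h1 i
        rcases edgeSign_eq_one_or D i.edge with h3 | h3 <;>
        rcases edgeSign_eq_one_or D' i.edge with h4 | h4 <;> simp [h3, h4] at this ⊢
    apply Digraph.ext
    funext u v
    rw [hD.1.adj_iff, hD'.1.adj_iff]
    exact propext (and_congr_right fun h => by rw [h2 _ h])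
  · rintro ⟨x, y⟩ -
    let N : Set (Sym2 (Site m₁ m₂ k)) := {e | ∃ i, EdgeIndex.edge i = e ∧ Sum.elim x y i = 1}
    have hN : ∀ i, EdgeIndex.edge i ∈ N ↔ Sum.elim x y i = 1 := fun i => by
      constructor
      · rintro ⟨j, hj, h⟩
        rwa [← EdgeIndex.edge_injective hm₂ hj]
      · exact fun h => ⟨i, rfl, h⟩
    have h1 : ∀ i, parityInd (edgeSign (orientationOf N) (EdgeIndex.edge i) = -1) =
        Sum.elim x y i := fun i => by
      have h2 := edgeSign_orientationOf_eq_one_iff N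
        ((mem_edgeSet_iff hm₁ hm₂).2 (Or.inr ⟨i, rfl⟩))
      have h3 : ∀ a : ZMod 2, a = 1 ∨ a = 0 := by decide
      rw [hN] at h2
      rcases h3 (Sum.elim x y i) with h4 | h4
      · rw [h4]
        apply parityInd_true
        exact (edgeSign_eq_one_or _ _).resolve_left fun h => h2.1 h h4
      · rw [h4]
        apply parityInd_false
        rw [h2.2 (by rw [h4]; decide)]
        decide
    refine ⟨orientationOf N, ?_, Prod.ext (funext fun i => h1 _) (funext fun i => h1 _)⟩
    simp only [Finset.coe_filter, Finset.mem_univ, true_and, Set.mem_ofPred_eq]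
    refine ⟨isOrientation_orientationOf N, fun e he => ?_⟩
    rw [edgeSign_orientationOf_eq_one_iff N ((mem_edgeSet_iff hm₁ hm₂).2 (Or.inl he))]
    rintro ⟨i, rfl, -⟩
    exact i.edge_not_mem_verticalEdges he

theorem prod_edgeSign (hm₁ : Odd m₁) (hm₂ : Odd m₂) {P : Finset (Sym2 (Site m₁ m₂ k))}
    (hP : ∀ e ∈ P, e ∈ (graph m₁ m₂ k).edgeSet) {D : Digraph (Site m₁ m₂ k)}
    (hD : ∀ e ∈ verticalEdges m₁ m₂ k, edgeSign D e = 1) :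
    ∏ e ∈ P, edgeSign D e =
      parityChar ((signVectors D).1 ⬝ᵥ leftVector P + (signVectors D).2 ⬝ᵥ rightVector P) := by
  classical
  rw [prod_eq_prod_edgeIndex hm₁ hm₂ hP hD, Finset.prod_filter, Fintype.prod_sum_type,
    parityChar_add, dotProduct, dotProduct, parityChar_sum, parityChar_sum]
  congr 1 <;>
  · refine Finset.prod_congr rfl fun i _ => ?_
    simp only [signVectors, leftVector, rightVector]
    split_ifs with h
    · rw [parityInd_true h, mul_one, ← edgeSign_eq_parityChar]
    · rw [parityInd_false h, mul_zero, parityChar_zero]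

open scoped Classical in
theorem leftVector_eq_zero_and_iff (hm₁ : Odd m₁) (hm₂ : Odd m₂)
    {P : Finset (Sym2 (Site m₁ m₂ k))} (hP : ∀ e ∈ P, e ∈ (graph m₁ m₂ k).edgeSet) :
    leftVector P = 0 ∧ rightVector P = 0 ↔ P ⊆ verticalEdges m₁ m₂ k := by
  have h0 : ∀ p : Prop, parityInd p = 0 ↔ ¬ p := fun p => by
    by_cases hp : p <;> simp [parityInd, hp]
  simp only [funext_iff, leftVector, rightVector, Pi.zero_apply, h0]
  constructor
  · rintro ⟨h1, h2⟩ e he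
    rcases (mem_edgeSet_iff hm₁ hm₂).1 (hP e he) with h | ⟨i | i, rfl⟩
    · exact h
    · exact absurd he (h1 i)
    · exact absurd he (h2 i)
  · exact fun h => ⟨fun i hi => EdgeIndex.edge_not_mem_verticalEdges _ (h hi),
      fun i hi => EdgeIndex.edge_not_mem_verticalEdges _ (h hi)⟩

open scoped Classical in
theorem sum_evenOrientations (hm₁ : Odd m₁) (hm₂ : Odd m₂) {M : Type*} [AddCommMonoid M]
    (F : (HalfIndex m₁ m₂ k → ZMod 2) × (HalfIndex m₁ m₂ k → ZMod 2) → M) :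
    ∑ D ∈ evenOrientations m₁ m₂ k, F (signVectors D) =
      ∑ x : (HalfIndex m₁ m₂ k → ZMod 2) × (HalfIndex m₁ m₂ k → ZMod 2) with
        x.1 ⬝ᵥ (formMatrix (layerCols m₁ m₂) (layerRows m₁ m₂ k)).mulVec x.2 = 0, F x := by
  rw [Finset.sum_filter, ← sum_orientations hm₁ hm₂, ← Finset.sum_filter, Finset.filter_filter]
  refine Finset.sum_congr ?_ fun _ _ => rfl
  ext D
  simp only [evenOrientations, Finset.mem_filter, even_card_pairs_iff hm₁ hm₂, and_assoc]

theorem two_mul_card_evenOrientations (hm₁ : Odd m₁) (hm₂ : Odd m₂) :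
    (2 : ℤ) * (evenOrientations m₁ m₂ k).card =
      2 ^ halfCount m₁ m₂ k * (2 ^ halfCount m₁ m₂ k + 1) := by
  classical
  have h := two_mul_sum_filter_bilinear
    (formMatrix_mul_formMatrixInv (layerCols m₁ m₂) (layerRows m₁ m₂ k)) 0 0
  rw [← sum_evenOrientations hm₁ hm₂
    fun x => parityChar (x.1 ⬝ᵥ (0 : HalfIndex m₁ m₂ k → ZMod 2) + x.2 ⬝ᵥ 0)] at h
  simpa [card_halfIndex hm₁ hm₂] using h

open scoped Classical in
theorem two_mul_sum_prod_edgeSign (hm₁ : Odd m₁) (hm₂ : Odd m₂)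
    {P : Finset (Sym2 (Site m₁ m₂ k))} (hP : IsDimer (graph m₁ m₂ k) P)
    (hev : ∀ e ∈ P, ∑ f ∈ P, (parityInd (Crosses e f) + parityInd (Crosses f e)) = 0) :
    2 * (∑ D ∈ evenOrientations m₁ m₂ k, ∏ e ∈ P, edgeSign D e) * parityChar (crossingParity P) =
      2 ^ halfCount m₁ m₂ k *
        ((if P ⊆ verticalEdges m₁ m₂ k then 2 ^ halfCount m₁ m₂ k else 0) + 1) := by
  have h := two_mul_sum_filter_bilinear
    (formMatrix_mul_formMatrixInv (layerCols m₁ m₂) (layerRows m₁ m₂ k))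
    (leftVector P) (rightVector P)
  have h1 : ∑ D ∈ evenOrientations m₁ m₂ k, ∏ e ∈ P, edgeSign D e =
      ∑ D ∈ evenOrientations m₁ m₂ k, parityChar ((signVectors D).1 ⬝ᵥ leftVector P +
        (signVectors D).2 ⬝ᵥ rightVector P) := by
    refine Finset.sum_congr rfl fun D hD => prod_edgeSign hm₁ hm₂ hP.1 ?_
    simp only [evenOrientations, Finset.mem_filter, Finset.mem_univ, true_and] at hD
    exact hD.2.1
  have h2 := crossingParity_eq_dotProduct hm₁ hm₂ hP hev
  rw [← h2, ← sum_evenOrientations hm₁ hm₂ fun x => parityChar (x.1 ⬝ᵥ leftVector P +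
    x.2 ⬝ᵥ rightVector P), ← h1, card_halfIndex hm₁ hm₂] at h
  rw [h, mul_assoc, add_mul, parityChar_mul_self]
  congr 2
  by_cases hv : P ⊆ verticalEdges m₁ m₂ k
  · have h3 := (leftVector_eq_zero_and_iff hm₁ hm₂ hP.1).2 hv
    rw [if_pos h3, if_pos hv, h2, h3.2, zero_dotProduct, parityChar_zero, mul_one]
  · rw [if_neg fun h3 => hv ((leftVector_eq_zero_and_iff hm₁ hm₂ hP.1).1 h3), if_neg hv, zero_mul]

end CubicLattice

namespace Site

variable {m₁ m₂ k : ℕ}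

theorem card_eq : Fintype.card (Site m₁ m₂ k) = m₁ * m₂ * k := by
  rw [← Fintype.card_congr (equivProd m₁ m₂ k), Fintype.card_prod, Fintype.card_prod,
    Fintype.card_fin, Fintype.card_fin, Fintype.card_fin, mul_assoc]

theorem exists_pos_eq {p : ℕ} (hp : p < m₁ * m₂ * k) : ∃ u : Site m₁ m₂ k, u.pos = p := by
  let f : Site m₁ m₂ k → Fin (m₁ * m₂ * k) := fun u => ⟨u.pos, u.pos_lt⟩
  have hf : Function.Bijective f := (Fintype.bijective_iff_injective_and_card f).2
    ⟨fun u v h => pos_injective (Fin.ext_iff.1 h), by rw [card_eq, Fintype.card_fin]⟩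
  obtain ⟨u, hu⟩ := hf.2 ⟨p, hp⟩
  exact ⟨u, Fin.ext_iff.1 hu⟩

theorem eq_of_column_eq {u v : Site m₁ m₂ k} (h : u.column = v.column) :
    u.x = v.x ∧ u.y = v.y := by
  have hyu := u.y.isLt
  have hyv := v.y.isLt
  obtain ⟨hx, hy⟩ := mixed_radix_inj (b := m₂) (by split_ifs <;> omega) (by split_ifs <;> omega) h
  rw [hx] at hy
  refine ⟨Fin.ext hx, Fin.ext ?_⟩
  split_ifs at hy <;> omega

end Site

namespace CubicLattice

variable {m₁ m₂ k : ℕ}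

theorem two_mul_card_classOne (hk : Even k) :
    2 * (classOne m₁ m₂ k).card = m₁ * m₂ * k := by
  have h : classTwo m₁ m₂ k = (classOne m₁ m₂ k)ᶜ := by
    ext u
    simp [classOne, classTwo]
  have h1 := Finset.card_add_card_compl (classOne m₁ m₂ k)
  rw [← h, card_classTwo hk, Site.card_eq] at h1
  omega

/-- The vertices of the first colour class, in increasing order. -/
noncomputable def rowSite (m₁ m₂ k : ℕ) : Fin (classOne m₁ m₂ k).card → Site m₁ m₂ k :=
  (classOne m₁ m₂ k).orderEmbOfFin rfl

/-- The vertices of the second colour class, in increasing order. -/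
noncomputable def colSite (hk : Even k) : Fin (classOne m₁ m₂ k).card → Site m₁ m₂ k :=
  (classTwo m₁ m₂ k).orderEmbOfFin (card_classTwo hk)

theorem pos_rowSite (hm₂ : Odd m₂) (hk : Even k) (a : Fin (classOne m₁ m₂ k).card) :
    (rowSite m₁ m₂ k a).pos = 2 * a := by
  have hc := two_mul_card_classOne (m₁ := m₁) (m₂ := m₂) hk
  choose f hf using fun a : Fin (classOne m₁ m₂ k).card =>
    Site.exists_pos_eq (m₁ := m₁) (m₂ := m₂) (k := k) (p := 2 * a) (by omega)
  rw [rowSite, ← Finset.orderEmbOfFin_unique rfl (f := f) _ _, hf]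
  · intro a
    simp [classOne, ← Site.even_pos hm₂ hk, hf]
  · intro a b hab
    rw [Site.lt_iff_pos_lt, hf, hf]
    have := Fin.lt_def.1 hab
    omega

theorem pos_colSite (hm₂ : Odd m₂) (hk : Even k) (a : Fin (classOne m₁ m₂ k).card) :
    (colSite (m₁ := m₁) (m₂ := m₂) hk a).pos = 2 * a + 1 := by
  have hc := two_mul_card_classOne (m₁ := m₁) (m₂ := m₂) hk
  choose f hf using fun a : Fin (classOne m₁ m₂ k).card =>
    Site.exists_pos_eq (m₁ := m₁) (m₂ := m₂) (k := k) (p := 2 * a + 1) (by omega)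
  rw [colSite, ← Finset.orderEmbOfFin_unique (card_classTwo hk) (f := f) _ _, hf]
  · intro a
    simp [classTwo, ← Nat.not_even_iff_odd, ← Site.even_pos hm₂ hk, hf]
  · intro a b hab
    rw [Site.lt_iff_pos_lt, hf, hf]
    have := Fin.lt_def.1 hab
    omega

theorem interlaced (hm₂ : Odd m₂) (hk : Even k) :
    Interlaced (rowSite m₁ m₂ k) (colSite (m₁ := m₁) (m₂ := m₂) hk) where
  left_lt_left a b := by
    rw [Site.lt_iff_pos_lt, pos_rowSite hm₂ hk, pos_rowSite hm₂ hk, Fin.lt_def]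
    omega
  left_lt_right a b := by
    rw [Site.lt_iff_pos_lt, pos_rowSite hm₂ hk, pos_colSite hm₂ hk, Fin.le_def]
    omega
  right_lt_left a b := by
    rw [Site.lt_iff_pos_lt, pos_rowSite hm₂ hk, pos_colSite hm₂ hk, Fin.lt_def]
    omega
  right_lt_right a b := by
    rw [Site.lt_iff_pos_lt, pos_colSite hm₂ hk, pos_colSite hm₂ hk, Fin.lt_def]
    omega

theorem exists_rowSite_or_colSite (hm₂ : Odd m₂) (hk : Even k) (u : Site m₁ m₂ k) :
    (∃ a, rowSite m₁ m₂ k a = u) ∨ ∃ a, colSite hk a = u := by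
  have hc := two_mul_card_classOne (m₁ := m₁) (m₂ := m₂) hk
  have hu := u.pos_lt
  rcases Nat.even_or_odd' u.pos with ⟨a, h | h⟩
  · refine Or.inl ⟨⟨a, by omega⟩, Site.pos_injective ?_⟩
    rw [pos_rowSite hm₂ hk, h]
  · refine Or.inr ⟨⟨a, by omega⟩, Site.pos_injective ?_⟩
    rw [pos_colSite hm₂ hk, h]

/-- The ends of an edge have different colours. -/
theorem even_add_of_adj (hm₂ : Odd m₂) (hk : Even k) {u v : Site m₁ m₂ k}
    (h : (graph m₁ m₂ k).Adj u v) : Even u.pos ↔ ¬ Even v.pos := by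
  rw [Site.even_pos hm₂ hk, Site.even_pos hm₂ hk]
  have h1 : s(u, v) ∈ (graph m₁ m₂ k).edgeSet := h
  rw [graph, SimpleGraph.edgeSet_fromEdgeSet, Set.mem_sdiff, Set.mem_ofPred_eq] at h1
  rcases h1.1 with h | ⟨x, h⟩ | h <;>
  simp only [verticalEdges, widthEdges, horizontalEdges, Finset.mem_filter, Finset.mem_univ,
    true_and] at h
  · obtain ⟨a, b, h, hx, hy, hz⟩ := h
    have : Even ((a.x : ℕ) + a.y + a.z) ↔ ¬ Even ((b.x : ℕ) + b.y + b.z) := by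
      rw [← hx, ← hy, ← hz, ← add_assoc, Nat.even_add_one, not_not]
    rcases Sym2.eq_iff.1 h with ⟨rfl, rfl⟩ | ⟨rfl, rfl⟩ <;> tauto
  · obtain ⟨a, b, h, hx, hx', hy, hz⟩ := h
    have : Even ((a.x : ℕ) + a.y + a.z) ↔ ¬ Even ((b.x : ℕ) + b.y + b.z) := by
      rw [hx, hx', ← hz, ← hy, show (x : ℕ) + (a.y + 1) + a.z = x + a.y + a.z + 1 by ring,
        Nat.even_add_one, not_not]
    rcases Sym2.eq_iff.1 h with ⟨rfl, rfl⟩ | ⟨rfl, rfl⟩ <;> tauto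
  · obtain ⟨a, b, h, hx, hy, hz⟩ := h
    have : Even ((a.x : ℕ) + a.y + a.z) ↔ ¬ Even ((b.x : ℕ) + b.y + b.z) := by
      rw [← hx, ← hy, ← hz, show (a.x : ℕ) + 1 + a.y + a.z = a.x + a.y + a.z + 1 by ring,
        Nat.even_add_one, not_not]
    rcases Sym2.eq_iff.1 h with ⟨rfl, rfl⟩ | ⟨rfl, rfl⟩ <;> tauto

theorem not_adj_rowSite (hm₂ : Odd m₂) (hk : Even k)
    (a b : Fin (classOne m₁ m₂ k).card) :
    ¬ (graph m₁ m₂ k).Adj (rowSite m₁ m₂ k a) (rowSite m₁ m₂ k b) := fun h => by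
  have := even_add_of_adj hm₂ hk h
  rw [pos_rowSite hm₂ hk, pos_rowSite hm₂ hk] at this
  simp at this

theorem not_adj_colSite (hm₂ : Odd m₂) (hk : Even k)
    (a b : Fin (classOne m₁ m₂ k).card) :
    ¬ (graph m₁ m₂ k).Adj (colSite hk a) (colSite hk b) := fun h => by
  have := even_add_of_adj hm₂ hk h
  rw [pos_colSite hm₂ hk, pos_colSite hm₂ hk] at this
  simp at this

/-! ### The matching of vertical edges -/

theorem rowSite_colSite_mem_verticalEdges (hm₂ : Odd m₂) (hk : Even k)
    (a : Fin (classOne m₁ m₂ k).card) :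
    s(rowSite m₁ m₂ k a, colSite hk a) ∈ verticalEdges m₁ m₂ k := by
  have h1 := pos_rowSite (m₁ := m₁) hm₂ hk a
  have h2 := pos_colSite (m₁ := m₁) hm₂ hk a
  generalize rowSite m₁ m₂ k a = u at *
  generalize colSite hk a = v at *
  have hu := u.height_lt
  have he : Even u.height := by
    have : Even u.pos := by rw [h1]; exact even_two_mul _
    rw [Site.pos, Nat.even_add] at this
    exact this.1 (hk.mul_left _)
  have hlt : u.height + 1 < k := by
    obtain ⟨b, hb⟩ := he
    obtain ⟨c, hc⟩ := hk
    omega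
  obtain ⟨hc, hh⟩ := Site.mixed_radix_inj (q := v.column) (q' := u.column) v.height_lt hlt (by
    rw [Site.pos] at h1 h2
    omega)
  obtain ⟨hx, hy⟩ := Site.eq_of_column_eq hc
  have hzu := u.z.isLt
  have hzv := v.z.isLt
  simp only [verticalEdges, Finset.mem_filter, Finset.mem_univ, true_and]
  simp only [Site.height, hc] at hh
  by_cases h : Even u.column
  · simp only [h, if_true] at hh
    exact ⟨u, v, rfl, hx.symm, hy.symm, hh.symm⟩
  · simp only [h, if_false] at hh
    exact ⟨v, u, Sym2.eq_swap, hx, hy, by omega⟩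

theorem _root_.Equiv.Perm.eq_one_of_forall_le {n : ℕ} {π : Equiv.Perm (Fin n)}
    (h : ∀ a, π a ≤ a) : π = 1 := by
  ext a
  induction a using WellFoundedLT.induction with
  | _ a ih =>
    by_contra hne
    have hlt : π a < a := lt_of_le_of_ne (h a) fun he => hne (congrArg Fin.val he)
    exact hlt.ne (π.injective (Fin.ext (ih _ hlt)))

theorem matchingOf_subset_verticalEdges_iff (hm₂ : Odd m₂) (hk : Even k)
    (π : Equiv.Perm (Fin (classOne m₁ m₂ k).card)) :
    matchingOf (rowSite m₁ m₂ k) (colSite hk) π ⊆ verticalEdges m₁ m₂ k ↔ π = 1 := by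
  constructor
  · intro h
    refine Equiv.Perm.eq_one_of_forall_le fun a => ?_
    have h1 := pos_sup_of_mem_verticalEdges (h (mem_matchingOf.2 ⟨a, rfl⟩))
    have h2 := pos_rowSite (m₁ := m₁) hm₂ hk a
    have h3 := pos_colSite (m₁ := m₁) hm₂ hk (π a)
    rw [Fin.le_def]
    rcases le_total (rowSite m₁ m₂ k a) (colSite hk (π a)) with hle | hle
    · rw [Sym2.sup_mk, Sym2.inf_mk, sup_of_le_right hle, inf_of_le_left hle] at h1
      omega
    · rw [Sym2.sup_mk, Sym2.inf_mk, sup_of_le_left hle, inf_of_le_right hle] at h1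
      omega
  · rintro rfl e he
    obtain ⟨a, rfl⟩ := mem_matchingOf.1 he
    exact rowSite_colSite_mem_verticalEdges hm₂ hk a

/-- The perfect matching that consists of vertical edges. -/
noncomputable def verticalMatching (m₁ m₂ : ℕ) (hk : Even k) : Finset (Sym2 (Site m₁ m₂ k)) :=
  matchingOf (rowSite m₁ m₂ k) (colSite hk) 1

theorem exists_perm_of_isDimer (hm₂ : Odd m₂) (hk : Even k)
    {P : Finset (Sym2 (Site m₁ m₂ k))} (hP : IsDimer (graph m₁ m₂ k) P) :
    ∃ π, matchingOf (rowSite m₁ m₂ k) (colSite hk) π = P :=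
  (exists_matchingOf_eq (interlaced hm₂ hk).left_injective (interlaced hm₂ hk).left_ne_right
    (exists_rowSite_or_colSite hm₂ hk) (not_adj_rowSite hm₂ hk)
    (not_adj_colSite hm₂ hk) hP).imp fun _ h => h.2

theorem isDimer_and_subset_iff (hm₁ : Odd m₁) (hm₂ : Odd m₂) (hk : Even k)
    (P : Finset (Sym2 (Site m₁ m₂ k))) :
    (IsDimer (graph m₁ m₂ k) P ∧ P ⊆ verticalEdges m₁ m₂ k) ↔
      P = verticalMatching m₁ m₂ hk := by
  have hi := interlaced (m₁ := m₁) hm₂ hk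
  constructor
  · rintro ⟨hP, hv⟩
    obtain ⟨π, rfl⟩ := exists_perm_of_isDimer hm₂ hk hP
    rw [(matchingOf_subset_verticalEdges_iff hm₂ hk π).1 hv, verticalMatching]
  · rintro rfl
    exact ⟨isDimer_matchingOf hi.left_injective hi.right_injective hi.left_ne_right
      (exists_rowSite_or_colSite hm₂ hk) fun a => (mem_edgeSet_iff hm₁ hm₂).2
        (Or.inl (rowSite_colSite_mem_verticalEdges hm₂ hk a)),
      (matchingOf_subset_verticalEdges_iff hm₂ hk 1).2 rfl⟩

theorem sum_crosses_add_crosses_eq_zero (hm₂ : Odd m₂) (hk : Even k)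
    {P : Finset (Sym2 (Site m₁ m₂ k))} (hP : IsDimer (graph m₁ m₂ k) P) :
    ∀ e ∈ P, ∑ f ∈ P, (parityInd (Crosses e f) + parityInd (Crosses f e)) = 0 := by
  have hi := interlaced (m₁ := m₁) hm₂ hk
  obtain ⟨π, rfl⟩ := exists_perm_of_isDimer hm₂ hk hP
  intro e he
  obtain ⟨a, rfl⟩ := mem_matchingOf.1 he
  rw [sum_matchingOf hi.left_injective hi.left_ne_right]
  exact hi.sum_crosses_add_crosses π a

open scoped Classical in
/-- Expansion of the determinant of a signing over perfect matchings. -/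
theorem det_signedMatrix (hm₂ : Odd m₂) (hk : Even k) {K : Type*} [Field K]
    (c : Sym2 (Site m₁ m₂ k) → K) (D : Digraph (Site m₁ m₂ k)) :
    (signedMatrix hk c D).det =
      ∑ P : Finset (Sym2 (Site m₁ m₂ k)) with IsDimer (graph m₁ m₂ k) P,
        (((∏ e ∈ P, edgeSign D e) * parityChar (crossingParity P) : ℤ) : K) * ∏ e ∈ P, c e := by
  have hi := interlaced (m₁ := m₁) hm₂ hk
  rw [sum_isDimer hi.left_injective hi.right_injective hi.left_ne_right
    (exists_rowSite_or_colSite hm₂ hk) (not_adj_rowSite hm₂ hk) (not_adj_colSite hm₂ hk),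
    ← Matrix.det_transpose, Matrix.det_apply', Finset.sum_filter]
  refine Finset.sum_congr rfl fun π _ => ?_
  have hentry : ∀ a, (signedMatrix hk c D).transpose (π a) a =
      (edgeSign D s(rowSite m₁ m₂ k a, colSite hk (π a)) : K) *
        entry c (rowSite m₁ m₂ k a) (colSite hk (π a)) := fun a => rfl
  simp_rw [hentry]
  split_ifs with h
  · have hent : ∀ a, entry c (rowSite m₁ m₂ k a) (colSite hk (π a)) =
        ((if rowSite m₁ m₂ k a < colSite hk (π a) then 1 else -1 : ℤ) : K) *
          c s(rowSite m₁ m₂ k a, colSite hk (π a)) := fun a => by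
      rw [entry, if_pos (h a)]
      split_ifs <;> simp
    simp_rw [hent]
    have hcr : crossingParity (matchingOf (rowSite m₁ m₂ k) (colSite hk) π) =
        ∑ a, ∑ b, parityInd (Crosses s(rowSite m₁ m₂ k a, colSite hk (π a))
          s(rowSite m₁ m₂ k b, colSite hk (π b))) := by
      rw [crossingParity, sum_matchingOf hi.left_injective hi.left_ne_right]
      exact Finset.sum_congr rfl fun a _ =>
        sum_matchingOf hi.left_injective hi.left_ne_right _ _
    rw [hcr, hi.parityChar_sum_crosses, prod_matchingOf hi.left_injective hi.left_ne_right,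
      prod_matchingOf hi.left_injective hi.left_ne_right, Finset.prod_mul_distrib,
      Finset.prod_mul_distrib]
    push_cast
    ring
  · obtain ⟨a, ha⟩ := not_forall.1 h
    rw [Finset.prod_eq_zero (Finset.mem_univ a), mul_zero]
    rw [entry, if_neg ha, mul_zero]

open scoped Classical in
theorem two_mul_sum_det (hm₁ : Odd m₁) (hm₂ : Odd m₂) (hk : Even k) {K : Type*} [Field K]
    (c : Sym2 (Site m₁ m₂ k) → K) :
    2 * ∑ D ∈ evenOrientations m₁ m₂ k, (signedMatrix hk c D).det =
      2 ^ halfCount m₁ m₂ k * (2 ^ halfCount m₁ m₂ k * ∏ e ∈ verticalMatching m₁ m₂ hk, c e +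
        dimerGenFun (graph m₁ m₂ k) c) := by
  simp_rw [det_signedMatrix hm₂ hk]
  have hM : ∏ e ∈ verticalMatching m₁ m₂ hk, c e =
      ∑ P : Finset (Sym2 (Site m₁ m₂ k)) with IsDimer (graph m₁ m₂ k) P,
        if P ⊆ verticalEdges m₁ m₂ k then ∏ e ∈ P, c e else 0 := by
    rw [← Finset.sum_filter, Finset.filter_filter]
    simp_rw [isDimer_and_subset_iff hm₁ hm₂ hk]
    rw [Finset.filter_eq', if_pos (Finset.mem_univ _), Finset.sum_singleton]
  rw [Finset.sum_comm, hM, dimerGenFun, Finset.mul_sum, Finset.mul_sum, ← Finset.sum_add_distrib,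
    Finset.mul_sum]
  refine Finset.sum_congr rfl fun P hP => ?_
  have hP' := (Finset.mem_filter.1 hP).2
  have h := congrArg (Int.cast : ℤ → K) (two_mul_sum_prod_edgeSign hm₁ hm₂ hP'
    (sum_crosses_add_crosses_eq_zero hm₂ hk hP'))
  rw [← Finset.sum_mul, ← Int.cast_sum, ← Finset.sum_mul]
  push_cast at h ⊢
  rw [← mul_assoc, ← mul_assoc, h]
  split_ifs <;> ring

theorem dimerGenFun_eq (hm₁ : Odd m₁) (hm₂ : Odd m₂) (hk : Even k) {K : Type*} [Field K]
    [CharZero K] (c : Sym2 (Site m₁ m₂ k) → K) :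
    dimerGenFun (graph m₁ m₂ k) c = (2 ^ halfCount m₁ m₂ k + 1) * avgDet hk c
      - 2 ^ halfCount m₁ m₂ k * ∏ e ∈ verticalMatching m₁ m₂ hk, c e := by
  have h1 := two_mul_sum_det hm₁ hm₂ hk c
  have h2 := congrArg (Int.cast : ℤ → K)
    (two_mul_card_evenOrientations (m₁ := m₁) (m₂ := m₂) (k := k) hm₁ hm₂)
  push_cast at h2
  have h3 : (2 : K) ^ halfCount m₁ m₂ k ≠ 0 := pow_ne_zero _ two_ne_zero
  have h4 : (2 : K) ^ halfCount m₁ m₂ k + 1 ≠ 0 := by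
    exact_mod_cast Nat.succ_ne_zero (2 ^ halfCount m₁ m₂ k)
  have h5 : ((evenOrientations m₁ m₂ k).card : K) ≠ 0 := fun h => by
    rw [h, mul_zero] at h2
    exact mul_ne_zero h3 h4 h2.symm
  have h6 : (2 ^ halfCount m₁ m₂ k + 1) * avgDet hk c =
      2 ^ halfCount m₁ m₂ k * ∏ e ∈ verticalMatching m₁ m₂ hk, c e +
        dimerGenFun (graph m₁ m₂ k) c := by
    rw [avgDet, ← mul_div_assoc, div_eq_iff h5]
    apply mul_left_cancel₀ (mul_ne_zero two_ne_zero h3)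
    linear_combination (2 ^ halfCount m₁ m₂ k) * (2 ^ halfCount m₁ m₂ k + 1) * h1 -
      2 ^ halfCount m₁ m₂ k * (2 ^ halfCount m₁ m₂ k * ∏ e ∈ verticalMatching m₁ m₂ hk, c e +
        dimerGenFun (graph m₁ m₂ k) c) * h2
  rw [h6]
  ring

end CubicLattice

theorem rpow_setWeight {V : Type*} (w : Sym2 V → ℝ) {α : ℝ} (hα : 0 < α)
    (A : Finset (Sym2 V)) : α ^ setWeight w A = ∏ e ∈ A, α ^ w e :=
  Real.rpow_sum_of_pos hα w A

theorem dimerPartition_eq_dimerGenFun {V : Type*} [Fintype V] (G : SimpleGraph V)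
    (w : Sym2 V → ℝ) {α : ℝ} (hα : 0 < α) :
    dimerPartition G w α = dimerGenFun G fun e => α ^ w e :=
  Finset.sum_congr rfl fun P _ => rpow_setWeight w hα P

open CubicLattice in
theorem theorem2 (m₁ m₂ k : ℕ) (hm₁ : Odd m₁) (hm₂ : Odd m₂) (hk : Even k) (hk0 : 0 < k) :
    ∃ M : Finset (Sym2 (Site m₁ m₂ k)),
      -- `M` is the unique perfect matching consisting of vertical edges only
      (∀ P : Finset (Sym2 (Site m₁ m₂ k)),
        (IsDimer (graph m₁ m₂ k) P ∧ P ⊆ verticalEdges m₁ m₂ k) ↔ P = M) ∧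
      -- the formula for edge weights `w`
      (∀ (w : Sym2 (Site m₁ m₂ k) → ℝ) (α : ℝ), 0 < α →
        dimerPartition (graph m₁ m₂ k) w α =
          (2 ^ halfCount m₁ m₂ k + 1) * avgDet hk (fun e => α ^ w e)
            - 2 ^ halfCount m₁ m₂ k * α ^ setWeight w M) ∧
      -- the same formula for arbitrary edge variables `c e`
      (∀ (K : Type*) [Field K] [CharZero K] (c : Sym2 (Site m₁ m₂ k) → K),
        dimerGenFun (graph m₁ m₂ k) c =
          (2 ^ halfCount m₁ m₂ k + 1) * avgDet hk c
            - 2 ^ halfCount m₁ m₂ k * ∏ e ∈ M, c e) := by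
  refine ⟨verticalMatching m₁ m₂ hk, isDimer_and_subset_iff hm₁ hm₂ hk, fun w α hα => ?_,
    fun K _ _ c => dimerGenFun_eq hm₁ hm₂ hk c⟩
  rw [dimerPartition_eq_dimerGenFun _ _ hα, rpow_setWeight w hα]
  exact dimerGenFun_eq hm₁ hm₂ hk _
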